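/- **Theorem (local input-to-state stability of the plant under regularized distributed MPC).** *Problem data.* There are $M$ agents with $x^i\in\mathbb R^{n^i}$, $u^i\in\mathbb R^{m^i}$ and matrices $A^i,B^i$; weights $Q^i,R^i,P^i$; polyhedra $\mathcal U^i=\{C_u^i\nu\le c_u^i\}$, $\mathcal X^i=\{C_x^i\xi\le c_x^i\}$, $\mathcal X_f^i=\{C_N^i\xi\le c_N^i\}$; coupling constraints $\sum_i E_u^iu^i+E_x^ix^i\le\bar b$ in $\mathbb R^p$; and a horizon $N\ge1$. Write $x=(x^1,\dots,x^M)$, $u=(u^1,\dots,u^M)$, $A=\mathrm{blkdiag}(A^i)$, $B=\mathrm{blkdiag}(B^i)$; $\|\cdot\|$ is the Euclidean norm and $\|z\|_W^2=z^\top Wz$. The optimal control problem with parameter $x$ is to minimize $$\sum_i\tfrac12\Big(\|\xi^i_N\|^2_{P^i}+\sum_{k=0}^{N-1}\big(\|\xi^i_k\|^2_{Q^i}+\|\nu^i_k\|^2_{R^i}\big)\Big)$$ subject to $\xi^i_0=x^i$, $\xi^i_N\in\mathcal X^i_f$ and, for $0\le k<N$, $\xi^i_{k+1}=A^i\xi^i_k+B^i\nu^i_k$,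 $\nu^i_k\in\mathcal U^i$, $\xi^i_k\in\mathcal X^i$, $\sum_iE_u^i\nu_k^i+E_x^i\xi_k^i\le\bar b$. Let $\Gamma_N$ be the set of $x$ for which these constraints are feasible. *Assumptions.* For every $i$: $(A^i,B^i)$ is stabilizable; $\mathcal X^i$, $\mathcal U^i$ and $\mathcal X^i_f$ contain the origin in their interior; $Q^i,R^i,P^i$ are symmetric positive definite. There are matrices $K^i\in\mathbb R^{m^i\times n^i}$ such that, for every $i$, $(A^i-B^iK^i)\mathcal X^i_f\subseteq\mathcal X^i_f$, $\mathcal X_f^i\subseteq\mathcal X^i$, $-K^i\mathcal X_f^i\subseteq\mathcal U^i$, and $\|(A^i-B^iK^i)z\|^2_{P^i}-\|z\|^2_{P^i}\le-\|z\|^2_{Q^i+(K^i)^\top R^iK^i}$ for all $z\in\mathbb R^{n^i}$, and such that $\sum_i(-E_u^iK^i+E_x^i)x^i\le\bar b$ whenever $x^i\in\mathcal X_f^i$ for all $i$. *Control law.* Eliminating the predicted states, let $f^i(u^i,x^i)$ be the cost of agent $i$ as a function of its input trajectory $u^i\in\mathbb R^{Nm^i}$, let $\mathcal Z^i(x^i)$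 be the set of $u^i$ satisfying the local input, state and terminal constraints, and write the stacked coupling constraints as $\sum_iF^ix^i+E^iu^i\le b$ in $\mathbb R^{Np}$. Let $h^i(\cdot,x^i)=f^i(\cdot,x^i)+\mathcal I_{\mathcal Z^i(x^i)}$ and $\mathcal E(x)=\{y:\sum_iF^ix^i+y\le b\}$, where $\mathcal I_\Omega$ is the $\{0,\infty\}$-valued indicator function, and let ${}^*$ denote the Fenchel conjugate. For $\epsilon>0$ let $S^d_\epsilon(x)$ be the minimizer over $\lambda\in\mathbb R^{Np}$ of $$\sum_i\big(h^i(\cdot,x^i)\big)^*\big(-(E^i)^\top\lambda\big)+\epsilon\|\lambda\|^2+\mathcal I^*_{\mathcal E(x)}(\lambda).$$ Let $q^i(\lambda,x^i)\in\mathbb R^{m^i}$ be the first-stage component of $\arg\min_{\zeta\in\mathcal Z^i(x^i)}f^i(\zeta,x^i)+\lambda^\top E^i\zeta$, and let $\kappa_\epsilon(x)=\big(q^i(S^d_\epsilon(x),x^i)\big)_i$. The law $\kappa_\epsilon$ is well defined on $\Gamma_N$; outside $\Gamma_N$ it is extended by a fixed convention, on which the conclusions do not depend. *Class $\mathcal{KL}$.*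 $\beta:\mathbb R_{\ge0}\times\mathbb R_{\ge0}\to\mathbb R_{\ge0}$ is of class $\mathcal{KL}$ if $\beta(\cdot,s)$ is continuous, strictly increasing and zero at $0$ for every $s\ge 0$, and $\beta(r,\cdot)$ is continuous, strictly decreasing and tends to $0$ at infinity for every $r>0$. *Conclusion.* There exist $\tilde\epsilon,\gamma_1,\sigma_1,\rho>0$ and $\beta_1\in\mathcal{KL}$, depending only on the problem data, such that for every $\epsilon\in(0,\tilde\epsilon]$, all bounded sequences $\delta u=(\delta u_t)_{t\in\mathbb N}$ and $d=(d_t)_{t\in\mathbb N}$, and every solution of $$x_{t+1}=Ax_t+B\big(\kappa_\epsilon(x_t)+\delta u_t\big)+d_t,\qquad t\in\mathbb N,$$ the following hold, with $\|v\|_\infty=\sup_t\|v_t\|$: 1. for every $t$ such that $x_0,\dots,x_t\in\Gamma_N$, $$\|x_t\|\le\beta_1(\|x_0\|,t)+\gamma_1\|\delta u\|_\infty+\sigma_1\|d\|_\infty;$$ 2. if $\|x_0\|\le\rho$, $\|\delta u\|_\infty\le\rho$ and $\|d\|_\infty\le\rho$, then $x_t\in\Gamma_N$ for all $t$ (and hence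 the bound in 1 holds for all $t$). -/

import Mathlib

open Filter Topology Matrix
open scoped Matrix Kronecker NNReal

noncomputable section

/-! ### Comparison functions -/

/-- Class `K`: continuous, strictly increasing, vanishing at `0`. -/
def ClassK (γ : ℝ≥0 → ℝ≥0) : Prop :=
  Continuous γ ∧ StrictMono γ ∧ γ 0 = 0

/-- Class `L`: continuous, strictly decreasing, tending to `0` at infinity. -/
def ClassL (σ : ℝ≥0 → ℝ≥0) : Prop :=
  Continuous σ ∧ StrictAnti σ ∧ Tendsto σ atTop (𝓝 0)

/-- Class `KL`: `β(·, s)` is of class `K` for every `s`, and `β(r, ·)` is of class `L` for every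
`r > 0` (for `r = 0` the first condition forces `β(0, ·) = 0`). -/
def ClassKL (β : ℝ≥0 → ℝ≥0 → ℝ≥0) : Prop :=
  (∀ s, ClassK fun r => β r s) ∧ ∀ r, 0 < r → ClassL (β r)

/-! ### Convex-analysis notions with values in the extended reals -/

/-- The indicator function of a set: `0` on the set, `+∞` off it. -/
def indicatorFn {α : Type*} (Ω : Set α) (x : α) : EReal := by
  classical exact if x ∈ Ω then 0 else ⊤

/-- The Fenchel conjugate `g^*(μ) = sup_ξ (⟨μ, ξ⟩ - g ξ)` of an extended-real-valued function. -/
def fenchelConj {ι : Type*} [Fintype ι] (g : (ι → ℝ) → EReal) (μ : ι → ℝ) : EReal :=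
  ⨆ ξ : ι → ℝ, ((μ ⬝ᵥ ξ : ℝ) : EReal) - g ξ

/-- A minimizer of `g` over `s` (`0` if there is none). -/
def argminOn {α β : Type*} [Preorder β] [Zero α] (s : Set α) (g : α → β) : α := by
  classical exact if h : ∃ a ∈ s, IsMinOn g s a then h.choose else 0

/-- The squared weighted norm `‖x‖_W² = xᵀ W x`. -/
def wnormSq {ι : Type*} [Fintype ι] (W : Matrix ι ι ℝ) (x : ι → ℝ) : ℝ := x ⬝ᵥ W *ᵥ x

/-- The pair `(A, B)` is stabilizable: some feedback `u = -K x` makes `A - B K` Schur stable. -/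
def Stabilizable {n m : ℕ} (A : Matrix (Fin n) (Fin n) ℝ) (B : Matrix (Fin n) (Fin m) ℝ) : Prop :=
  ∃ K : Matrix (Fin m) (Fin n) ℝ, Tendsto (fun k : ℕ => (A - B * K) ^ k) atTop (𝓝 0)

/-! ### The multi-agent optimal control problem -/

/-- The data of the optimal control problem: `M` agents with linear dynamics `(A i, B i)`, quadratic
weights `Q i`, `R i`, `P i`, polyhedral local input, state and terminal constraints, `p` coupling
constraints, and a horizon `N ≥ 1`. -/
structure MPCProblem where
  /-- number of agents -/
  M : ℕ
  /-- state dimensions -/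
  n : Fin M → ℕ
  /-- input dimensions -/
  m : Fin M → ℕ
  /-- number of coupling constraints -/
  p : ℕ
  /-- number of local input constraints -/
  rU : Fin M → ℕ
  /-- number of local state constraints -/
  rX : Fin M → ℕ
  /-- number of terminal constraints -/
  rN : Fin M → ℕ
  /-- prediction horizon -/
  N : ℕ
  N_pos : 0 < N
  A : ∀ i, Matrix (Fin (n i)) (Fin (n i)) ℝ
  B : ∀ i, Matrix (Fin (n i)) (Fin (m i)) ℝ
  Q : ∀ i, Matrix (Fin (n i)) (Fin (n i)) ℝ
  R : ∀ i, Matrix (Fin (m i)) (Fin (m i)) ℝ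
  P : ∀ i, Matrix (Fin (n i)) (Fin (n i)) ℝ
  Cu : ∀ i, Matrix (Fin (rU i)) (Fin (m i)) ℝ
  cu : ∀ i, Fin (rU i) → ℝ
  Cx : ∀ i, Matrix (Fin (rX i)) (Fin (n i)) ℝ
  cx : ∀ i, Fin (rX i) → ℝ
  CN : ∀ i, Matrix (Fin (rN i)) (Fin (n i)) ℝ
  cN : ∀ i, Fin (rN i) → ℝ
  Eu : ∀ i, Matrix (Fin p) (Fin (m i)) ℝ
  Ex : ∀ i, Matrix (Fin p) (Fin (n i)) ℝ
  bbar : Fin p → ℝ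

namespace MPCProblem

variable (S : MPCProblem)

/-- Stacked states `x = (x¹, …, x^M)`, with the Euclidean norm. -/
abbrev State : Type := PiLp 2 fun i : Fin S.M => EuclideanSpace ℝ (Fin (S.n i))

/-- Stacked inputs `u = (u¹, …, u^M)`, with the Euclidean norm. -/
abbrev Input : Type := PiLp 2 fun i : Fin S.M => EuclideanSpace ℝ (Fin (S.m i))

/-- The local input constraint set. -/
def inputSet (i : Fin S.M) : Set (Fin (S.m i) → ℝ) := {ν | S.Cu i *ᵥ ν ≤ S.cu i}

/-- The local state constraint set. -/
def stateSet (i : Fin S.M) : Set (Fin (S.n i) → ℝ) := {ξ | S.Cx i *ᵥ ξ ≤ S.cx i}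

/-- The terminal set. -/
def terminalSet (i : Fin S.M) : Set (Fin (S.n i) → ℝ) := {ξ | S.CN i *ᵥ ξ ≤ S.cN i}

/-- The coupling constraint at one stage. -/
def CouplingOK (ξ : ∀ i, Fin (S.n i) → ℝ) (ν : ∀ i, Fin (S.m i) → ℝ) : Prop :=
  ∑ i, (S.Eu i *ᵥ ν i + S.Ex i *ᵥ ξ i) ≤ S.bbar

/-- The family of gains `K` makes the terminal sets invariant under `u^i = -K^i x^i` and admissible
for the input, state and coupling constraints, and the terminal weights satisfy the decrease
condition. -/
structure TerminalIngredients (K : ∀ i, Matrix (Fin (S.m i)) (Fin (S.n i)) ℝ) : Prop where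
  invariant : ∀ i, ∀ x ∈ S.terminalSet i, (S.A i - S.B i * K i) *ᵥ x ∈ S.terminalSet i
  state_admissible : ∀ i, S.terminalSet i ⊆ S.stateSet i
  input_admissible : ∀ i, ∀ x ∈ S.terminalSet i, -(K i *ᵥ x) ∈ S.inputSet i
  coupling_admissible : ∀ x : ∀ i, Fin (S.n i) → ℝ, (∀ i, x i ∈ S.terminalSet i) →
    S.CouplingOK x fun i => -(K i *ᵥ x i)
  decrease : ∀ i, ∀ x : Fin (S.n i) → ℝ,
    wnormSq (S.P i) ((S.A i - S.B i * K i) *ᵥ x) - wnormSq (S.P i) x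
      ≤ -wnormSq (S.Q i + (K i)ᵀ * S.R i * K i) x

/-- The standing assumptions on the problem data. -/
structure StandingAssumption : Prop where
  stabilizable : ∀ i, Stabilizable (S.A i) (S.B i)
  zero_mem_interior_stateSet : ∀ i, 0 ∈ interior (S.stateSet i)
  zero_mem_interior_inputSet : ∀ i, 0 ∈ interior (S.inputSet i)
  zero_mem_interior_terminalSet : ∀ i, 0 ∈ interior (S.terminalSet i)
  Q_posDef : ∀ i, (S.Q i).PosDef
  R_posDef : ∀ i, (S.R i).PosDef
  P_posDef : ∀ i, (S.P i).PosDef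
  terminal : ∃ K, S.TerminalIngredients K

/-- Feasibility of predicted states `ξ` and inputs `ν` for the optimal control problem with measured
state `x`. -/
structure Feasible (x : S.State) (ξ : ∀ i, Fin (S.N + 1) → Fin (S.n i) → ℝ)
    (ν : ∀ i, Fin S.N → Fin (S.m i) → ℝ) : Prop where
  dynamics : ∀ i, ∀ k : Fin S.N, ξ i k.succ = S.A i *ᵥ ξ i k.castSucc + S.B i *ᵥ ν i k
  initial : ∀ i, ξ i 0 = (x i).ofLp
  terminal : ∀ i, ξ i (Fin.last S.N) ∈ S.terminalSet i
  input : ∀ i, ∀ k, ν i k ∈ S.inputSet i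
  state : ∀ i, ∀ k : Fin S.N, ξ i k.castSucc ∈ S.stateSet i
  coupling : ∀ k : Fin S.N, S.CouplingOK (fun i => ξ i k.castSucc) fun i => ν i k

/-- The set `Γ_N` of feasible parameters. -/
def feasibleSet : Set S.State := {x | ∃ ξ ν, S.Feasible x ξ ν}

/-! ### Condensed form: the predicted states are eliminated -/

/-- The prediction matrix `Â`: block row `k` is `A^k`. -/
def Ahat (i : Fin S.M) : Matrix (Fin (S.N + 1) × Fin (S.n i)) (Fin (S.n i)) ℝ :=
  Matrix.of fun kr s => (S.A i ^ (kr.1 : ℕ)) kr.2 s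

/-- The prediction matrix `B̂`: block `(k, j)` is `A^(k-1-j) B` for `j < k`, and `0` otherwise. -/
def Bhat (i : Fin S.M) : Matrix (Fin (S.N + 1) × Fin (S.n i)) (Fin S.N × Fin (S.m i)) ℝ :=
  Matrix.of fun kr js =>
    if (js.1 : ℕ) < kr.1 then (S.A i ^ ((kr.1 : ℕ) - 1 - js.1) * S.B i) kr.2 js.2 else 0

/-- The predicted state of agent `i` at stage `k` from state `x` under the input trajectory `u`. -/
def predState (i : Fin S.M) (x : Fin (S.n i) → ℝ) (u : Fin S.N × Fin (S.m i) → ℝ)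
    (k : Fin (S.N + 1)) : Fin (S.n i) → ℝ :=
  fun r => (S.Ahat i *ᵥ x + S.Bhat i *ᵥ u) (k, r)

/-- The condensed cost `f^i(u^i, x^i)`. -/
def localCost (i : Fin S.M) (u : Fin S.N × Fin (S.m i) → ℝ) (x : Fin (S.n i) → ℝ) : ℝ :=
  (1 / 2) * (wnormSq (S.P i) (S.predState i x u (Fin.last S.N)) +
    ∑ k : Fin S.N, (wnormSq (S.Q i) (S.predState i x u k.castSucc) +
      wnormSq (S.R i) fun s => u (k, s)))

/-- The condensed local constraint set `𝒵^i(x^i)`. -/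
def localSet (i : Fin S.M) (x : Fin (S.n i) → ℝ) : Set (Fin S.N × Fin (S.m i) → ℝ) :=
  {u | (∀ k : Fin S.N, (fun s => u (k, s)) ∈ S.inputSet i) ∧
    (∀ k : Fin S.N, S.predState i x u k.castSucc ∈ S.stateSet i) ∧
    S.predState i x u (Fin.last S.N) ∈ S.terminalSet i}

/-- The matrix `F^i` of the condensed coupling constraints `∑ F^i x^i + E^i u^i ≤ b`. -/
def F (i : Fin S.M) : Matrix (Fin S.N × Fin S.p) (Fin (S.n i)) ℝ :=
  ((1 : Matrix (Fin S.N) (Fin S.N) ℝ) ⊗ₖ S.Ex i) *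
    (S.Ahat i).submatrix (Prod.map Fin.castSucc id) id

/-- The matrix `E^i` of the condensed coupling constraints `∑ F^i x^i + E^i u^i ≤ b`. -/
def E (i : Fin S.M) : Matrix (Fin S.N × Fin S.p) (Fin S.N × Fin (S.m i)) ℝ :=
  ((1 : Matrix (Fin S.N) (Fin S.N) ℝ) ⊗ₖ S.Ex i) *
    (S.Bhat i).submatrix (Prod.map Fin.castSucc id) id +
  (1 : Matrix (Fin S.N) (Fin S.N) ℝ) ⊗ₖ S.Eu i

/-- The right-hand side `b` of the condensed coupling constraints. -/
def b : Fin S.N × Fin S.p → ℝ := fun kr => S.bbar kr.2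

/-! ### The regularized dual problem and the control law -/

/-- `h^i(u^i, x^i)`: local cost plus the indicator of the local constraints. -/
def h (i : Fin S.M) (x : Fin (S.n i) → ℝ) (u : Fin S.N × Fin (S.m i) → ℝ) : EReal :=
  (S.localCost i u x : EReal) + indicatorFn (S.localSet i x) u

/-- The parametric set `ℰ(x)`. -/
def couplingSet (x : S.State) : Set (Fin S.N × Fin S.p → ℝ) :=
  {y | ∑ i, S.F i *ᵥ (x i).ofLp + y ≤ S.b}

/-- The regularized dual cost
`∑ i, (h^i(·, x^i))^*(-(E^i)ᵀ λ) + ε ‖λ‖² + (indicator of ℰ(x))^*(λ)`. -/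
def dualCost (ε : ℝ) (x : S.State) (lam : Fin S.N × Fin S.p → ℝ) : EReal :=
  ∑ i, fenchelConj (S.h i (x i).ofLp) (-((S.E i)ᵀ *ᵥ lam)) + ((ε * (lam ⬝ᵥ lam) : ℝ) : EReal) +
    fenchelConj (indicatorFn (S.couplingSet x)) lam

/-- The solution `S^d_ε(x)` of the regularized dual problem. -/
def dualSol (ε : ℝ) (x : S.State) : Fin S.N × Fin S.p → ℝ :=
  argminOn Set.univ (S.dualCost ε x)

/-- The input trajectory of agent `i` recovered from the multiplier `λ`: the minimizer over
`𝒵^i(x^i)` of `f^i(·, x^i) + λᵀ E^i ·`. -/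
def primalRecovery (i : Fin S.M) (lam : Fin S.N × Fin S.p → ℝ) (x : Fin (S.n i) → ℝ) :
    Fin S.N × Fin (S.m i) → ℝ :=
  argminOn (S.localSet i x) fun u => S.localCost i u x + lam ⬝ᵥ S.E i *ᵥ u

/-- The map `q(λ, x)`: first-stage components of the recovered input trajectories. -/
def q (lam : Fin S.N × Fin S.p → ℝ) (x : S.State) : S.Input :=
  WithLp.toLp 2 fun i => WithLp.toLp 2 fun s =>
    S.primalRecovery i lam (x i).ofLp (⟨0, S.N_pos⟩, s)

/-- The regularized MPC law `κ_ε(x) = q(S^d_ε(x), x)`. -/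
def kappa (ε : ℝ) (x : S.State) : S.Input := S.q (S.dualSol ε x) x

/-- The right-hand side `A x + B u + d` of the stacked dynamics. -/
def plant (x : S.State) (u : S.Input) (d : S.State) : S.State :=
  WithLp.toLp 2 fun i => WithLp.toLp 2 (S.A i *ᵥ (x i).ofLp + S.B i *ᵥ (u i).ofLp + (d i).ofLp)

end MPCProblem

/-- The norm `‖v‖_∞ = sup_t ‖v_t‖` of a bounded sequence. -/
def supNorm {V : Type*} [Norm V] (v : ℕ → V) : ℝ := ⨆ t, ‖v t‖

end

/-!
The dual of the regularized dual problem is a primal problem in which the coupling constraints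
`G (u, x) ≤ b` are replaced by the quadratic penalty `(4ε)⁻¹ ‖(G (u, x) - b)₊‖²`. Its solution `u`
and the scaled constraint violation `lam = (2ε)⁻¹ (G (u, x) - b)₊` satisfy the optimality conditions
`IsPenaltyKKT`, which identify `lam` with `dualSol` and, agent by agent, `u` with `primalRecovery`;
so `κ_ε(x)` is the first stage of the penalized optimal input (`kappa_eq_of_isPenaltyKKT`).

The only fact about polyhedra needed is that the fibres of a polyhedral set depend on the parameter
in a globally Lipschitz way (`IsPolyhedral.exists_lipschitz_fibres`), proved by Fourier–Motzkin
elimination of one coordinate at a time. It has three uses. The optimal cost is at most a multiple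
of `‖x‖²` on the whole feasible set; the square root `V` of the optimal cost is Lipschitz there; and
the penalized and the constrained optimal inputs differ by at most `O(√ε) V(x)`
(`IsPenaltyKKT.exists_error_bound`). In particular no constraint qualification at the origin, where
coupling constraints may be active, and no boundedness of the feasible set is required.

The terminal ingredients make the exact law recursively feasible and decrease the optimal cost by
the first stage cost (`exists_successor`), so `V` contracts by a factor `η < 1` along it. Since the
cost is the square of a Euclidean norm of `(u, x)`, perturbing the successor state by the
regularization error, `δu` and `d` changes `V` by at most a multiple of the perturbation, whence
`V(x⁺) ≤ θ V(x) + γ (‖δu‖ + ‖d‖)` with `θ < 1` for all small `ε` (`exists_issLyapunov`). Iterating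
gives the estimate with an exponential `β₁`. Its a priori bounds keep the state in a ball around the
origin contained in the terminal sets, hence in the feasible set, when the data are small.
-/

noncomputable section

/-! ### Polyhedral sets and their Lipschitz dependence on parameters -/

/-- A polyhedral set: the solution set of finitely many non-strict linear inequalities. -/
def IsPolyhedral {V : Type*} [AddCommGroup V] [Module ℝ V] (C : Set V) : Prop :=
  ∃ (ι : Type) (_ : Fintype ι) (a : ι → V →ₗ[ℝ] ℝ) (β : ι → ℝ), C = {v | ∀ j, a j v ≤ β j}

namespace IsPolyhedral

variable {V W : Type*} [AddCommGroup V] [Module ℝ V] [AddCommGroup W] [Module ℝ W]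

theorem halfspace (a : V →ₗ[ℝ] ℝ) (β : ℝ) : IsPolyhedral {v | a v ≤ β} :=
  ⟨Unit, inferInstance, fun _ => a, fun _ => β, by simp⟩

theorem univ : IsPolyhedral (Set.univ : Set V) :=
  ⟨Empty, inferInstance, fun j => j.elim, fun j => j.elim, by simp⟩

theorem forall_mem {κ : Type} [Fintype κ] {C : κ → Set V} (hC : ∀ k, IsPolyhedral (C k)) :
    IsPolyhedral {v | ∀ k, v ∈ C k} := by
  choose ι hι a β h using hC
  refine ⟨Σ k, ι k, inferInstance, fun j => a j.1 j.2, fun j => β j.1 j.2, ?_⟩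
  ext v
  simp only [h, Set.mem_ofPred_eq, Sigma.forall]

theorem inter {C D : Set V} (hC : IsPolyhedral C) (hD : IsPolyhedral D) :
    IsPolyhedral (C ∩ D) := by
  have h := forall_mem (κ := Bool) (C := fun k => if k then C else D)
    (by rintro (_ | _) <;> simpa)
  convert h using 1
  ext v
  simp [and_comm]

theorem preimage {C : Set W} (hC : IsPolyhedral C) (T : V →ₗ[ℝ] W) : IsPolyhedral (T ⁻¹' C) := by
  obtain ⟨ι, hι, a, β, rfl⟩ := hC
  exact ⟨ι, hι, fun j => a j ∘ₗ T, β, rfl⟩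

theorem convex {C : Set V} (hC : IsPolyhedral C) : Convex ℝ C := by
  obtain ⟨ι, hι, a, β, rfl⟩ := hC
  have : {v | ∀ j, a j v ≤ β j} = ⋂ j, {v | a j v ≤ β j} := by ext; simp
  rw [this]
  exact convex_iInter fun j => convex_halfSpace_le (a j).isLinear (β j)

theorem isClosed {V : Type*} [NormedAddCommGroup V] [NormedSpace ℝ V] [FiniteDimensional ℝ V]
    {C : Set V} (hC : IsPolyhedral C) : IsClosed C := by
  obtain ⟨ι, hι, a, β, rfl⟩ := hC
  have : {v | ∀ j, a j v ≤ β j} = ⋂ j, {v | a j v ≤ β j} := by ext; simp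
  rw [this]
  exact isClosed_iInter fun j =>
    isClosed_le (a j).continuous_of_finiteDimensional continuous_const

end IsPolyhedral

/-- One step of Fourier–Motzkin elimination: finitely many inequalities `α j * t ≤ φ j` have a
common solution iff the rows without `t` hold and every upper bound dominates every lower bound. -/
theorem exists_forall_mul_le_iff {ι : Type*} [Finite ι] (α φ : ι → ℝ) :
    (∃ t, ∀ j, α j * t ≤ φ j) ↔
      (∀ j, α j = 0 → 0 ≤ φ j) ∧ ∀ i j, 0 < α i → α j < 0 → α j * φ i ≤ α i * φ j := by
  have := Fintype.ofFinite ι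
  constructor
  · rintro ⟨t, ht⟩
    refine ⟨fun j hj => by simpa [hj] using ht j, fun i j hi hj => ?_⟩
    nlinarith [mul_le_mul_of_nonneg_left (ht j) hi.le,
      mul_le_mul_of_nonpos_left (ht i) hj.le]
  · rintro ⟨h0, h1⟩
    classical
    by_cases hne : ((Finset.univ : Finset ι).filter fun j => α j < 0).Nonempty
    · obtain ⟨j, hj, hmax⟩ := Finset.exists_max_image _ (fun j => φ j / α j) hne
      simp only [Finset.mem_filter, Finset.mem_univ, true_and] at hj hmax
      refine ⟨φ j / α j, fun i => ?_⟩
      rcases lt_trichotomy (α i) 0 with hi | hi | hi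
      · have := hmax i hi
        rwa [div_le_iff_of_neg hi, mul_comm] at this
      · simpa [hi] using h0 i hi
      · have := h1 i j hi hj
        rw [← mul_div_assoc, div_le_iff_of_neg hj]
        linarith
    · have hneg : ∀ j, 0 ≤ α j := by
        intro j
        by_contra hj
        exact hne ⟨j, by simpa using hj⟩
      by_cases hne' : ((Finset.univ : Finset ι).filter fun j => 0 < α j).Nonempty
      · obtain ⟨j, hj, hmin⟩ := Finset.exists_min_image _ (fun j => φ j / α j) hne'
        simp only [Finset.mem_filter, Finset.mem_univ, true_and] at hj hmin
        refine ⟨φ j / α j, fun i => ?_⟩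
        rcases (hneg i).eq_or_lt with hi | hi
        · simpa [← hi] using h0 i hi.symm
        · have := hmin i hi
          rwa [le_div_iff₀ hi, mul_comm] at this
      · refine ⟨0, fun i => ?_⟩
        have : α i = 0 := by
          refine le_antisymm ?_ (hneg i)
          by_contra hi
          exact hne' ⟨i, by simpa using hi⟩
        simpa [this] using h0 i this

/-- Polyhedral sets in `U × Y` have polyhedral projections to `Y`, and their fibres depend on the
point of `Y` in a Lipschitz way, with a single constant for the whole projection. -/
def HasLipschitzFibres (U : Type) [NormedAddCommGroup U] [NormedSpace ℝ U] : Prop :=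
  ∀ (Y : Type) [NormedAddCommGroup Y] [NormedSpace ℝ Y] [FiniteDimensional ℝ Y] (C : Set (U × Y)),
    IsPolyhedral C → IsPolyhedral (Prod.snd '' C) ∧
      ∃ c : ℝ, 0 ≤ c ∧ ∀ u y, (u, y) ∈ C → ∀ y' ∈ Prod.snd '' C,
        ∃ u', (u', y') ∈ C ∧ ‖u' - u‖ ≤ c * ‖y' - y‖

theorem LinearMap.exists_norm_le {V W : Type*} [NormedAddCommGroup V] [NormedSpace ℝ V]
    [FiniteDimensional ℝ V] [NormedAddCommGroup W] [NormedSpace ℝ W] (T : V →ₗ[ℝ] W) :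
    ∃ c : ℝ, 0 < c ∧ ∀ v, ‖T v‖ ≤ c * ‖v‖ := by
  refine ⟨‖T.toContinuousLinearMap‖ + 1, by positivity, fun v => ?_⟩
  have := T.toContinuousLinearMap.le_opNorm v
  simp only [LinearMap.coe_toContinuousLinearMap'] at this
  nlinarith [norm_nonneg v]

theorem LinearMap.exists_norm_ge {V W : Type*} [NormedAddCommGroup V] [NormedSpace ℝ V]
    [FiniteDimensional ℝ V] [NormedAddCommGroup W] [NormedSpace ℝ W] (T : V →ₗ[ℝ] W)
    (hT : ∀ v, T v = 0 → v = 0) : ∃ c : ℝ, 0 < c ∧ ∀ v, ‖v‖ ≤ c * ‖T v‖ := by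
  obtain ⟨K, hK, h⟩ := T.exists_antilipschitzWith (LinearMap.ker_eq_bot'.2 hT)
  refine ⟨K, hK, fun v => ?_⟩
  simpa using h.le_mul_dist v 0

theorem hasLipschitzFibres_real : HasLipschitzFibres ℝ := by
  rintro Y _ _ _ C ⟨ι, hι, a, β, rfl⟩
  -- The rows read `α j * t + ℓ j y ≤ β j`.
  set α : ι → ℝ := fun j => a j (1, 0) with hα
  set ℓ : ι → Y →ₗ[ℝ] ℝ := fun j => a j ∘ₗ LinearMap.inr ℝ ℝ Y with hℓ
  have hrow : ∀ j t y, a j (t, y) ≤ β j ↔ α j * t ≤ β j - ℓ j y := by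
    intro j t y
    have : a j (t, y) = α j * t + ℓ j y := by
      have h1 : ((t, y) : ℝ × Y) = t • ((1, 0) : ℝ × Y) + (0, y) := by simp
      rw [h1, map_add, map_smul]
      simp [hα, hℓ, mul_comm]
    rw [this]
    constructor <;> intro h <;> linarith
  have hproj : ∀ y, y ∈ Prod.snd '' {v : ℝ × Y | ∀ j, a j v ≤ β j} ↔
      ∃ t, ∀ j, α j * t ≤ β j - ℓ j y := by
    intro y
    simp [hrow]
  refine ⟨?_, ?_⟩
  · have hset : Prod.snd '' {v : ℝ × Y | ∀ j, a j v ≤ β j} =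
        {y | ∀ j : ι, y ∈ {y | α j = 0 → 0 ≤ β j - ℓ j y}} ∩
          {y | ∀ k : ι × ι, y ∈ {y | 0 < α k.1 → α k.2 < 0 →
            α k.2 * (β k.1 - ℓ k.1 y) ≤ α k.1 * (β k.2 - ℓ k.2 y)}} := by
      ext y
      rw [hproj, exists_forall_mul_le_iff]
      simp
    rw [hset]
    refine .inter (.forall_mem fun j => ?_) (.forall_mem fun k => ?_)
    · by_cases hj : α j = 0
      · simpa [hj] using IsPolyhedral.halfspace (ℓ j) (β j)
      · simpa [hj] using IsPolyhedral.univ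
    · by_cases hk : 0 < α k.1 ∧ α k.2 < 0
      · convert IsPolyhedral.halfspace (α k.1 • ℓ k.2 - α k.2 • ℓ k.1)
          (α k.1 * β k.2 - α k.2 * β k.1) using 1
        ext y
        simp only [hk.1, hk.2, forall_const, Set.mem_ofPred_eq, LinearMap.sub_apply,
          LinearMap.smul_apply, smul_eq_mul]
        constructor <;> intro h <;> linarith
      · convert IsPolyhedral.univ using 1
        ext y
        simp only [Set.mem_ofPred_eq, Set.mem_univ, iff_true]
        exact fun h1 h2 => absurd ⟨h1, h2⟩ hk
  · choose c hc hcb using fun j => (ℓ j).exists_norm_le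
    refine ⟨∑ j, c j / |α j|, Finset.sum_nonneg fun j _ => by have := hc j; positivity, ?_⟩
    intro t y hty y' hy'
    rw [hproj] at hy'
    obtain ⟨s, hs⟩ := hy'
    set τ := (∑ j, c j / |α j|) * ‖y' - y‖ with hτ
    have hτ0 : 0 ≤ τ := mul_nonneg
      (Finset.sum_nonneg fun j _ => by have := hc j; positivity) (norm_nonneg _)
    have hkey : ∀ j, α j ≠ 0 → ℓ j y' - ℓ j y ≤ |α j| * τ := by
      intro j hj
      have h1 : c j / |α j| ≤ ∑ j, c j / |α j| :=
        Finset.single_le_sum (f := fun j => c j / |α j|)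
          (fun j _ => by have := hc j; positivity) (Finset.mem_univ j)
      have h2 := hcb j (y' - y)
      rw [map_sub, Real.norm_eq_abs] at h2
      have h3 : c j ≤ |α j| * ∑ j, c j / |α j| := by
        rwa [div_le_iff₀' (abs_pos.2 hj)] at h1
      calc _ ≤ c j * ‖y' - y‖ := (le_abs_self _).trans h2
        _ ≤ _ := by rw [hτ, ← mul_assoc]; gcongr
    -- The solution `s` over `y'` is clamped to the interval of radius `τ` around `t`.
    refine ⟨max (t - τ) (min s (t + τ)), ?_, ?_⟩
    · intro j
      rw [hrow]
      have ht := (hrow j t y).1 (hty j)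
      have hsj := hs j
      rcases lt_trichotomy (α j) 0 with hj | hj | hj
      · have h := hkey j hj.ne
        rw [abs_of_neg hj] at h
        rcases le_total s (t + τ) with h1 | h1
        · rw [min_eq_left h1]
          nlinarith [le_max_right (t - τ) s]
        · rw [min_eq_right h1]
          nlinarith [le_max_right (t - τ) (t + τ)]
      · simpa [hj] using hsj
      · have h := hkey j hj.ne'
        rw [abs_of_pos hj] at h
        rcases le_total (t - τ) (min s (t + τ)) with h1 | h1
        · rw [max_eq_right h1]
          nlinarith [min_le_left s (t + τ)]
        · rw [max_eq_left h1]
          nlinarith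
    · rw [Real.norm_eq_abs, abs_le]
      constructor
      · linarith [le_max_left (t - τ) (min s (t + τ))]
      · have : max (t - τ) (min s (t + τ)) ≤ t + τ :=
          max_le (by linarith) (min_le_right _ _)
        linarith

theorem HasLipschitzFibres.prod {U₁ U₂ : Type} [NormedAddCommGroup U₁] [NormedSpace ℝ U₁]
    [NormedAddCommGroup U₂] [NormedSpace ℝ U₂] [FiniteDimensional ℝ U₂]
    (h₁ : HasLipschitzFibres U₁) (h₂ : HasLipschitzFibres U₂) :
    HasLipschitzFibres (U₁ × U₂) := by
  intro Y _ _ _ C hC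
  have hassoc : IsPolyhedral {v : U₁ × (U₂ × Y) | ((v.1, v.2.1), v.2.2) ∈ C} :=
    hC.preimage (LinearEquiv.prodAssoc ℝ U₁ U₂ Y).symm.toLinearMap
  obtain ⟨hp₁, c₁, hc₁, hl₁⟩ := h₁ (U₂ × Y) _ hassoc
  obtain ⟨hp₂, c₂, hc₂, hl₂⟩ := h₂ Y _ hp₁
  refine ⟨?_, ?_⟩
  · convert hp₂ using 1
    ext y
    simpa using exists_comm
  · refine ⟨max (c₁ * max c₂ 1) c₂, by positivity, ?_⟩
    rintro ⟨u₁, u₂⟩ y hu y' ⟨⟨⟨v₁, v₂⟩, z⟩, hv, rfl⟩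
    obtain ⟨w₂, hw₂, hn₂⟩ := hl₂ u₂ y ⟨(u₁, u₂, y), hu, rfl⟩ z ⟨(v₂, z), ⟨(v₁, v₂, z), hv, rfl⟩, rfl⟩
    obtain ⟨w₁, hw₁, hn₁⟩ := hl₁ u₁ (u₂, y) hu (w₂, z) hw₂
    refine ⟨(w₁, w₂), hw₁, ?_⟩
    have h3 : ‖((w₂, z) : U₂ × Y) - (u₂, y)‖ ≤ max c₂ 1 * ‖z - y‖ := by
      rw [Prod.mk_sub_mk, Prod.norm_mk, max_mul_of_nonneg _ _ (norm_nonneg _), one_mul]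
      exact max_le_max hn₂ le_rfl
    rw [Prod.mk_sub_mk, Prod.norm_mk, max_mul_of_nonneg _ _ (norm_nonneg _), mul_assoc]
    exact max_le_max (hn₁.trans (mul_le_mul_of_nonneg_left h3 hc₁)) hn₂

theorem HasLipschitzFibres.of_linearEquiv {U U' : Type} [NormedAddCommGroup U] [NormedSpace ℝ U]
    [FiniteDimensional ℝ U]
    [NormedAddCommGroup U'] [NormedSpace ℝ U'] (h : HasLipschitzFibres U) (e : U ≃ₗ[ℝ] U') :
    HasLipschitzFibres U' := by
  intro Y _ _ _ C hC
  have hpre : IsPolyhedral {v : U × Y | (e v.1, v.2) ∈ C} :=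
    hC.preimage (e.toLinearMap.prodMap LinearMap.id)
  obtain ⟨hp, c, hc, hl⟩ := h Y _ hpre
  have hproj : Prod.snd '' {v : U × Y | (e v.1, v.2) ∈ C} = Prod.snd '' C := by
    ext y
    simp only [Set.mem_image, Set.mem_ofPred_eq, Prod.exists, exists_eq_right]
    exact ⟨fun ⟨u, hu⟩ => ⟨_, hu⟩, fun ⟨u, hu⟩ => ⟨e.symm u, by simpa using hu⟩⟩
  rw [hproj] at hp hl
  obtain ⟨k, hk, hek⟩ := e.toLinearMap.exists_norm_le
  refine ⟨hp, k * c, by positivity, ?_⟩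
  intro u y hu y' hy'
  obtain ⟨w, hw, hn⟩ := hl (e.symm u) y (by simpa using hu) y' hy'
  refine ⟨e w, hw, ?_⟩
  have := hek (w - e.symm u)
  simp only [LinearEquiv.coe_coe, map_sub, LinearEquiv.apply_symm_apply] at this
  rw [mul_assoc]
  exact this.trans (mul_le_mul_of_nonneg_left hn hk.le)

theorem hasLipschitzFibres_fin (d : ℕ) : HasLipschitzFibres (Fin d → ℝ) := by
  induction d with
  | zero =>
    rintro Y _ _ _ C hC
    refine ⟨?_, 0, le_rfl, ?_⟩
    · convert hC.preimage (LinearMap.inr ℝ (Fin 0 → ℝ) Y) using 1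
      ext y
      simp only [Set.mem_image, Prod.exists, exists_eq_right, Set.mem_preimage,
        LinearMap.inr_apply]
      exact ⟨fun ⟨u, hu⟩ => by rwa [Subsingleton.elim 0 u], fun h => ⟨_, h⟩⟩
    · rintro u y hu y' ⟨⟨w, z⟩, hw, rfl⟩
      exact ⟨w, hw, by simp [Subsingleton.elim w u]⟩
  | succ d ih =>
    exact (hasLipschitzFibres_real.prod ih).of_linearEquiv
      (Fin.consLinearEquiv ℝ fun _ : Fin (d + 1) => ℝ)

/-- Lipschitz dependence of the fibres of a polyhedral set on the parameter (a form of Hoffman's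
error bound), by eliminating one coordinate at a time. -/
theorem IsPolyhedral.exists_lipschitz_fibres {U Y : Type} [NormedAddCommGroup U] [NormedSpace ℝ U]
    [FiniteDimensional ℝ U] [NormedAddCommGroup Y] [NormedSpace ℝ Y] [FiniteDimensional ℝ Y]
    {C : Set (U × Y)} (hC : IsPolyhedral C) :
    ∃ c : ℝ, 0 ≤ c ∧ ∀ u y v y', (u, y) ∈ C → (v, y') ∈ C →
      ∃ u', (u', y') ∈ C ∧ ‖u' - u‖ ≤ c * ‖y' - y‖ := by
  obtain ⟨-, c, hc, h⟩ := ((hasLipschitzFibres_fin _).of_linearEquiv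
    (Module.finBasis ℝ U).equivFun.symm) Y C hC
  exact ⟨c, hc, fun u y v y' hu hv => h u y hu y' ⟨_, hv, rfl⟩⟩

/-! ### Quadratic programs with penalized coupling constraints -/

theorem IsPolyhedral.setOf_map_le {V : Type*} [AddCommGroup V] [Module ℝ V] {κ : Type} [Fintype κ]
    (G : V →ₗ[ℝ] κ → ℝ) (β : κ → ℝ) : IsPolyhedral {v | G v ≤ β} :=
  ⟨κ, inferInstance, fun k => LinearMap.proj k ∘ₗ G, β, by ext; simp [Pi.le_def]⟩

/-- A strongly convex least-squares problem over a nonempty closed convex set has a minimizer, given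
here by its variational inequality. -/
theorem exists_variational_min {V H : Type*} [NormedAddCommGroup V] [NormedSpace ℝ V]
    [FiniteDimensional ℝ V] [NormedAddCommGroup H] [InnerProductSpace ℝ H]
    [CompleteSpace H] (T : V →ₗ[ℝ] H)
    (hT : ∀ v, T v = 0 → v = 0) (h₀ : H) {D : Set V} (hD : D.Nonempty) (hconv : Convex ℝ D)
    (hcl : IsClosed D) : ∃ w ∈ D, ∀ v ∈ D, 0 ≤ inner ℝ (h₀ + T w) (T (v - w)) := by
  have hcl' := (LinearMap.isClosedEmbedding_of_injective (LinearMap.ker_eq_bot'.2 hT)).isClosedMap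
    _ hcl
  obtain ⟨_, ⟨w, hw, rfl⟩, hmin⟩ := exists_norm_eq_iInf_of_complete_convex (hD.image T)
    hcl'.isComplete
    (hconv.linear_image T) (-h₀)
  rw [norm_eq_iInf_iff_real_inner_le_zero (hconv.linear_image T) ⟨w, hw, rfl⟩] at hmin
  refine ⟨w, hw, fun v hv => ?_⟩
  have := hmin _ ⟨v, hv, rfl⟩
  rw [← neg_add', inner_neg_left, ← map_sub] at this
  linarith

section Penalty

variable {U X H : Type} {κ : Type} [Fintype κ]
  [NormedAddCommGroup U] [NormedSpace ℝ U] [NormedAddCommGroup X] [NormedSpace ℝ X]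
  [NormedAddCommGroup H] [InnerProductSpace ℝ H]

/-- Optimality conditions for minimizing the penalized cost
`½ ‖L (u, x)‖² + (4ε)⁻¹ ‖(G (u, x) - b)₊‖²` over the inputs `u` with `(u, x) ∈ Z`, where
`2 ε • lam` is the positive part of the constraint violation `G (u, x) - b`. The pair `(u, lam)` is
also the saddle point of the Lagrangian with the dual regularization `-ε ‖lam‖²`. -/
structure IsPenaltyKKT (L : U × X →ₗ[ℝ] H) (Z : Set (U × X)) (G : U × X →ₗ[ℝ] κ → ℝ) (b : κ → ℝ)
    (ε : ℝ) (x : X) (u : U) (lam : κ → ℝ) : Prop where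
  mem : (u, x) ∈ Z
  nonneg : 0 ≤ lam
  violation_le : G (u, x) - b ≤ (2 * ε) • lam
  slack : lam ⬝ᵥ (G (u, x) - b) = 2 * ε * (lam ⬝ᵥ lam)
  stationary : ∀ v, (v, x) ∈ Z → 0 ≤ inner ℝ (L (u, x)) (L (v - u, 0)) + lam ⬝ᵥ G (v - u, 0)

/-- The inputs, parameters and constraint levels `(u, (x, s))` with `(u, x) ∈ Z` and
`G (u, x) - b ≤ s`. -/
def relaxedSet (Z : Set (U × X)) (G : U × X →ₗ[ℝ] κ → ℝ) (b : κ → ℝ) :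
    Set (U × (X × (κ → ℝ))) :=
  {v | (v.1, v.2.1) ∈ Z ∧ G (v.1, v.2.1) - b ≤ v.2.2}

theorem isPolyhedral_relaxedSet {Z : Set (U × X)} (hZ : IsPolyhedral Z) (G : U × X →ₗ[ℝ] κ → ℝ)
    (b : κ → ℝ) : IsPolyhedral (relaxedSet Z G b) := by
  let T : U × (X × (κ → ℝ)) →ₗ[ℝ] U × X :=
    (LinearMap.fst ℝ _ _).prod (LinearMap.fst ℝ _ _ ∘ₗ LinearMap.snd ℝ _ _)
  let s : U × (X × (κ → ℝ)) →ₗ[ℝ] κ → ℝ := LinearMap.snd ℝ _ _ ∘ₗ LinearMap.snd ℝ _ _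
  convert (hZ.preimage T).inter (.setOf_map_le (G ∘ₗ T - s) b) using 1
  ext v
  simp only [relaxedSet, Set.mem_ofPred_eq, Set.mem_inter_iff, Set.mem_preimage,
    LinearMap.sub_apply, LinearMap.comp_apply]
  refine and_congr Iff.rfl ?_
  rw [sub_le_comm]
  rfl

variable [FiniteDimensional ℝ U] [FiniteDimensional ℝ X]

/-- The penalized problem is the projection of the origin onto a polyhedron once the constraint
level `s ≥ G (u, x) - b` is made a variable; its solution yields the multiplier `s / (2ε)`. -/
theorem IsPenaltyKKT.exists_of_mem [CompleteSpace H] {L : U × X →ₗ[ℝ] H} (hL : ∀ w, L w = 0 → w = 0) {Z : Set (U × X)}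
    (hZ : IsPolyhedral Z) (G : U × X →ₗ[ℝ] κ → ℝ) (b : κ → ℝ) {ε : ℝ} (hε : 0 < ε) {x : X} {v : U}
    (hv : (v, x) ∈ Z) : ∃ u lam, IsPenaltyKKT L Z G b ε x u lam := by
  classical
  have h2ε : (0 : ℝ) < 2 * ε := by positivity
  -- The level is scaled so that its squared norm enters with the weight `(2ε)⁻¹`.
  let r : ℝ := Real.sqrt (2 * ε)⁻¹
  have hr : r * r = (2 * ε)⁻¹ := Real.mul_self_sqrt (by positivity)
  have hr0 : r ≠ 0 := (Real.sqrt_pos.2 (by positivity)).ne'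
  let T : U × (κ → ℝ) →ₗ[ℝ] WithLp 2 (H × EuclideanSpace ℝ κ) :=
    (WithLp.linearEquiv 2 ℝ (H × EuclideanSpace ℝ κ)).symm.toLinearMap ∘ₗ
      (L ∘ₗ LinearMap.inl ℝ U X).prodMap
        (r • (WithLp.linearEquiv 2 ℝ (κ → ℝ)).symm.toLinearMap)
  have hTinner : ∀ (h : H) (p q : U × (κ → ℝ)),
      inner ℝ (WithLp.toLp 2 ((h, 0) : H × EuclideanSpace ℝ κ) + T p) (T q) =
        inner ℝ (h + L (p.1, 0)) (L (q.1, 0)) + (2 * ε)⁻¹ * (p.2 ⬝ᵥ q.2) := by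
    intro h p q
    rw [WithLp.prod_inner_apply, ← hr]
    simp [T, PiLp.inner_apply, dotProduct, Finset.mul_sum]
    refine Finset.sum_congr rfl fun k _ => by ring
  have hTinj : ∀ p, T p = 0 → p = 0 := by
    intro p hp
    have h1 : L (p.1, 0) = 0 := congrArg (fun z => z.ofLp.1) hp
    have h2 : r • (WithLp.toLp 2 p.2 : EuclideanSpace ℝ κ) = 0 := congrArg (fun z => z.ofLp.2) hp
    have h3 := hL _ h1
    have h4 := (smul_eq_zero.1 h2).resolve_left hr0
    ext k
    · simpa using congrArg Prod.fst h3
    · simpa using congrArg (fun z => z.ofLp k) h4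
  let emb : U × (κ → ℝ) → U × (X × (κ → ℝ)) := fun p => (p.1, (x, p.2))
  let D : Set (U × (κ → ℝ)) := {p | (p.1, x) ∈ Z ∧ G (p.1, x) - b ≤ p.2}
  have hDconv : Convex ℝ D := by
    intro p hp q hq a c ha hc hac
    have := (isPolyhedral_relaxedSet hZ G b).convex
      (x := (p.1, (x, p.2))) hp (y := (q.1, (x, q.2))) hq ha hc hac
    have hx : a • x + c • x = x := by rw [← add_smul, hac, one_smul]
    simpa [relaxedSet, D, hx] using this
  have hDcl : IsClosed D := by
    have hemb : Continuous emb := by fun_prop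
    exact (isPolyhedral_relaxedSet hZ G b).isClosed.preimage hemb
  obtain ⟨⟨u, s⟩, ⟨huZ, hus⟩, hvar⟩ := exists_variational_min T hTinj
    (WithLp.toLp 2 ((L (0, x), 0) : H × EuclideanSpace ℝ κ)) (D := D)
    ⟨(v, G (v, x) - b), hv, le_rfl⟩ hDconv hDcl
  have hLx : L (0, x) + L (u, 0) = L (u, x) := by rw [← map_add]; simp
  have hvar' : ∀ u' s', (u', x) ∈ Z → G (u', x) - b ≤ s' →
      0 ≤ inner ℝ (L (u, x)) (L (u' - u, 0)) + (2 * ε)⁻¹ * (s ⬝ᵥ (s' - s)) := by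
    intro u' s' h1 h2
    have := hvar (u', s') ⟨h1, h2⟩
    rwa [hTinner, hLx] at this
  have hL0 : L (u - u, 0) = 0 := by rw [sub_self]; exact map_zero L
  have hinv : (0 : ℝ) < (2 * ε)⁻¹ := by positivity
  -- Raising one level shows `s ≥ 0`; lowering `s` to the violation gives complementarity.
  have hs0 : 0 ≤ s := by
    intro k
    have := hvar' u (s + Pi.single k 1) huZ (hus.trans (by simp))
    rw [hL0, inner_zero_right, zero_add, add_sub_cancel_left, dotProduct_single_one] at this
    exact (mul_nonneg_iff_of_pos_left hinv).1 this
  have hcomp : s ⬝ᵥ (G (u, x) - b) = s ⬝ᵥ s := by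
    refine le_antisymm (dotProduct_le_dotProduct_of_nonneg_left hus hs0) ?_
    have := hvar' u (G (u, x) - b) huZ le_rfl
    rw [hL0, inner_zero_right, zero_add, mul_nonneg_iff_of_pos_left hinv, dotProduct_sub] at this
    linarith
  refine ⟨u, (2 * ε)⁻¹ • s, huZ, ?_, ?_, ?_, ?_⟩
  · intro k
    exact mul_nonneg hinv.le (hs0 k)
  · rwa [smul_smul, mul_inv_cancel₀ h2ε.ne', one_smul]
  · rw [smul_dotProduct, smul_dotProduct, dotProduct_smul, hcomp]
    simp only [smul_eq_mul]
    field_simp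
  · intro u' hu'
    have := hvar' u' (G (u', x) - b) hu' le_rfl
    have hG : G (u', x) - b = G (u' - u, 0) + (G (u, x) - b) := by
      rw [← add_sub_assoc, ← map_add]; simp
    rw [hG, dotProduct_sub, dotProduct_add, hcomp] at this
    rw [smul_dotProduct, smul_eq_mul]
    linarith

/-- The penalized solution is within `O(√ε)` of the constrained one, relative to the square root of
the optimal cost: a point of `Z` violating the coupling constraints by `2 ε • lam` is `O(ε ‖lam‖)`
away from a feasible point. -/
theorem IsPenaltyKKT.exists_error_bound {L : U × X →ₗ[ℝ] H} (hL : ∀ w, L w = 0 → w = 0)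
    {Z : Set (U × X)} (hZ : IsPolyhedral Z) (G : U × X →ₗ[ℝ] κ → ℝ) (b : κ → ℝ) :
    ∃ c : ℝ, 0 < c ∧ ∀ (ε : ℝ) (x : X) (u : U) (lam : κ → ℝ) (w : U), 0 < ε →
      IsPenaltyKKT L Z G b ε x u lam → (w, x) ∈ Z → G (w, x) ≤ b →
      (∀ v, (v, x) ∈ Z → G (v, x) ≤ b → 0 ≤ inner ℝ (L (w, x)) (L (v - w, 0))) →
      ‖u - w‖ ≤ c * Real.sqrt ε * ‖L (w, x)‖ := by
  obtain ⟨c₁, hc₁, hlip⟩ := (isPolyhedral_relaxedSet hZ G b).exists_lipschitz_fibres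
  obtain ⟨c₂, hc₂, hLle⟩ := (L ∘ₗ LinearMap.inl ℝ U X).exists_norm_le
  obtain ⟨c₃, hc₃, hLge⟩ := (L ∘ₗ LinearMap.inl ℝ U X).exists_norm_ge (fun v hv => by
    simpa using congrArg Prod.fst (hL _ hv))
  simp only [LinearMap.comp_apply, LinearMap.inl_apply] at hLle hLge
  refine ⟨c₃ * (c₂ * c₁ + 1), by positivity, ?_⟩
  intro ε x u lam w hε hk hwZ hwb hw
  obtain ⟨v, ⟨hvZ, hvb⟩, hvn⟩ := hlip u (x, (2 * ε) • lam) w (x, 0) ⟨hk.mem, hk.violation_le⟩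
    ⟨hwZ, by simpa using hwb⟩
  have hvb' : G (v, x) ≤ b := by simpa using hvb
  have hn : ‖v - u‖ ≤ c₁ * (2 * ε * ‖lam‖) := by
    refine hvn.trans_eq ?_
    rw [Prod.mk_sub_mk, sub_self, zero_sub, Prod.norm_mk, norm_neg, norm_smul, norm_zero,
      max_eq_right (by positivity), Real.norm_of_nonneg (by positivity)]
  have hlam : ‖lam‖ ^ 2 ≤ lam ⬝ᵥ lam := by
    have h0 : 0 ≤ lam ⬝ᵥ lam := Finset.sum_nonneg fun k _ => mul_self_nonneg _
    rw [← Real.le_sqrt (norm_nonneg _) h0]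
    refine (pi_norm_le_iff_of_nonneg (Real.sqrt_nonneg _)).2 fun k => ?_
    rw [Real.norm_eq_abs]
    refine Real.abs_le_sqrt ?_
    rw [sq]
    exact Finset.single_le_sum (f := fun k => lam k * lam k) (fun k _ => mul_self_nonneg _)
      (Finset.mem_univ k)
  have h1 : 2 * ε * (lam ⬝ᵥ lam) ≤ inner ℝ (L (u, x)) (L (w - u, 0)) := by
    have h := hk.stationary w hwZ
    have hG : G (w - u, 0) = (G (w, x) - b) - (G (u, x) - b) := by
      rw [sub_sub_sub_cancel_right, ← map_sub]; simp
    have hle : lam ⬝ᵥ (G (w, x) - b) ≤ 0 := by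
      have := dotProduct_le_dotProduct_of_nonneg_left (sub_nonpos.2 hwb) hk.nonneg
      simpa using this
    rw [hG, dotProduct_sub, hk.slack] at h
    linarith
  have h2 := hw v hvZ hvb'
  have hsplit : L (v - w, 0) = L (v - u, 0) + L (u - w, 0) := by rw [← map_add]; simp
  have hneg : L (w - u, 0) = -L (u - w, 0) := by rw [← map_neg]; simp
  have hdiff : L (u, x) = L (w, x) + L (u - w, 0) := by rw [← map_add]; simp
  rw [hsplit, inner_add_right] at h2
  rw [hneg, hdiff, inner_neg_right, inner_add_left, real_inner_self_eq_norm_sq] at h1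
  have h3 : inner ℝ (L (w, x)) (L (v - u, 0)) ≤ ‖L (w, x)‖ * (c₂ * (c₁ * (2 * ε * ‖lam‖))) := by
    refine (real_inner_le_norm _ _).trans ?_
    gcongr
    exact (hLle _).trans (by gcongr)
  set z := ‖lam‖
  set J := ‖L (w, x)‖
  -- `2 ε (c₁ c₂ J z - z²)` is at most `ε (c₁ c₂ J)²`
  have h4 : ‖L (u - w, 0)‖ ^ 2 ≤ ((c₂ * c₁) * Real.sqrt ε * J) ^ 2 := by
    have hsq : Real.sqrt ε ^ 2 = ε := Real.sq_sqrt hε.le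
    have h5 : ((c₂ * c₁) * Real.sqrt ε * J) ^ 2 = ε * (c₂ * c₁ * J) ^ 2 := by
      rw [mul_pow, mul_pow, hsq]; ring
    rw [h5]
    nlinarith [mul_nonneg hε.le (sq_nonneg (c₂ * c₁ * J - z)), mul_nonneg hε.le (sq_nonneg z),
      mul_le_mul_of_nonneg_left hlam hε.le]
  have h6 : ‖L (u - w, 0)‖ ≤ (c₂ * c₁) * Real.sqrt ε * J :=
    le_of_sq_le_sq h4 (by positivity)
  calc ‖u - w‖ ≤ c₃ * ‖L (u - w, 0)‖ := hLge _
    _ ≤ c₃ * ((c₂ * c₁ + 1) * Real.sqrt ε * J) := by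
      gcongr
      refine h6.trans ?_
      gcongr
      linarith
    _ = _ := by ring

end Penalty

/-! ### The condensed problem along state and input sequences -/

namespace MPCProblem

variable (S : MPCProblem)

/-- Stacked input trajectories over the horizon. -/
abbrev InputTraj : Type := ∀ i : Fin S.M, Fin S.N × Fin (S.m i) → ℝ

theorem predState_apply (i : Fin S.M) (x : Fin (S.n i) → ℝ) (u : Fin S.N × Fin (S.m i) → ℝ)
    (k : Fin (S.N + 1)) : S.predState i x u k = (S.A i ^ (k : ℕ)) *ᵥ x +
      ∑ j : Fin S.N, if (j : ℕ) < k then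
        (S.A i ^ ((k : ℕ) - 1 - j) * S.B i) *ᵥ (fun s => u (j, s)) else 0 := by
  ext r
  simp only [predState, Ahat, Bhat, Pi.add_apply, mulVec, dotProduct, Matrix.of_apply,
    Fintype.sum_prod_type, Finset.sum_apply]
  congr 1
  refine Finset.sum_congr rfl fun j _ => ?_
  split_ifs <;> simp [mulVec, dotProduct]

/-- The predicted states are those of any state sequence that obeys the dynamics under an input
sequence extending the input trajectory. -/
theorem predState_eq_of_dynamics (i : Fin S.M) {z : ℕ → Fin (S.n i) → ℝ} {v : ℕ → Fin (S.m i) → ℝ}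
    (hz : ∀ k, z (k + 1) = S.A i *ᵥ z k + S.B i *ᵥ v k) (k : Fin (S.N + 1)) :
    S.predState i (z 0) (fun js => v js.1 js.2) k = z k := by
  have hsum : ∀ k : ℕ, z k = (S.A i ^ k) *ᵥ z 0 +
      ∑ j ∈ Finset.range k, (S.A i ^ (k - 1 - j) * S.B i) *ᵥ v j := by
    intro k
    induction k with
    | zero => simp
    | succ k ih =>
      rw [hz, Finset.sum_range_succ, ih, mulVec_add, mulVec_mulVec, ← pow_succ', mulVec_sum,
        add_assoc]
      congr 2
      · refine Finset.sum_congr rfl fun j hj => ?_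
        have hj' := Finset.mem_range.1 hj
        rw [mulVec_mulVec, ← Matrix.mul_assoc, ← pow_succ']
        congr 3
        omega
      · simp
  rw [predState_apply, hsum k]
  congr 1
  rw [Fin.sum_univ_eq_sum_range (fun j => if j < (k : ℕ) then
    (S.A i ^ ((k : ℕ) - 1 - j) * S.B i) *ᵥ (fun s => v j s) else 0) S.N, ← Finset.sum_filter]
  refine Finset.sum_congr ?_ fun _ _ => rfl
  ext j
  have := k.2
  simp only [Finset.mem_filter, Finset.mem_range]
  omega

/-- The condensed coupling map `(u, x) ↦ ∑ F^i x^i + E^i u^i`. -/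
def couplingMap : S.InputTraj × S.State →ₗ[ℝ] Fin S.N × Fin S.p → ℝ where
  toFun w := ∑ i, (S.F i *ᵥ (w.2 i).ofLp + S.E i *ᵥ w.1 i)
  map_add' w w' := by
    rw [← Finset.sum_add_distrib]
    refine Finset.sum_congr rfl fun i _ => ?_
    simp only [Prod.fst_add, Prod.snd_add, PiLp.add_apply, WithLp.ofLp_add, Pi.add_apply,
      mulVec_add]
    abel
  map_smul' c w := by
    simp only [Prod.smul_fst, Prod.smul_snd, PiLp.smul_apply, WithLp.ofLp_smul, Pi.smul_apply,
      mulVec_smul, RingHom.id_apply, Finset.smul_sum, smul_add]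

theorem couplingMap_apply (w : S.InputTraj × S.State) :
    S.couplingMap w = ∑ i, (S.F i *ᵥ (w.2 i).ofLp + S.E i *ᵥ w.1 i) := rfl

theorem one_kronecker_mulVec {N p n : ℕ} (E : Matrix (Fin p) (Fin n) ℝ) (y : Fin N × Fin n → ℝ)
    (k : Fin N) (r : Fin p) :
    (((1 : Matrix (Fin N) (Fin N) ℝ) ⊗ₖ E) *ᵥ y) (k, r) = (E *ᵥ fun s => y (k, s)) r := by
  simp [mulVec, dotProduct, Fintype.sum_prod_type, Matrix.one_apply, ite_mul, Finset.sum_ite_irrel]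

theorem condensed_coupling_apply (i : Fin S.M) (x : Fin (S.n i) → ℝ)
    (u : Fin S.N × Fin (S.m i) → ℝ) (k : Fin S.N) (r : Fin S.p) :
    (S.F i *ᵥ x + S.E i *ᵥ u) (k, r) =
      (S.Eu i *ᵥ (fun s => u (k, s)) + S.Ex i *ᵥ S.predState i x u k.castSucc) r := by
  simp only [F, E, add_mulVec, ← mulVec_mulVec, Pi.add_apply, one_kronecker_mulVec]
  have : S.predState i x u k.castSucc = (fun s =>
      ((S.Ahat i).submatrix (Prod.map Fin.castSucc id) id *ᵥ x) (k, s)) +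
      fun s => ((S.Bhat i).submatrix (Prod.map Fin.castSucc id) id *ᵥ u) (k, s) := by
    ext s
    simp [predState, mulVec, dotProduct]
  rw [this, mulVec_add, Pi.add_apply]
  ring

theorem couplingMap_le_iff (w : S.InputTraj × S.State) :
    S.couplingMap w ≤ S.b ↔ ∀ k : Fin S.N, S.CouplingOK
      (fun i => S.predState i (w.2 i).ofLp (w.1 i) k.castSucc) (fun i s => w.1 i (k, s)) := by
  simp only [Pi.le_def, Prod.forall, CouplingOK, couplingMap_apply, Finset.sum_apply,
    condensed_coupling_apply, b]

/-- The pairs of input trajectories and states that satisfy all local constraints. -/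
def localGraph : Set (S.InputTraj × S.State) := {w | ∀ i, w.1 i ∈ S.localSet i (w.2 i).ofLp}

/-- The pairs of input trajectories and states that satisfy the constraints of the condensed
optimal control problem. -/
def feasibleGraph : Set (S.InputTraj × S.State) :=
  {w | w ∈ S.localGraph ∧ S.couplingMap w ≤ S.b}

/-- The cost of the optimal control problem. -/
def totalCost (u : S.InputTraj) (x : S.State) : ℝ := ∑ i, S.localCost i (u i) (x i).ofLp

/-- State and input sequences of all agents, on an infinite horizon, that obey the dynamics. -/
structure IsTrajectory (z : ∀ i, ℕ → Fin (S.n i) → ℝ) (v : ∀ i, ℕ → Fin (S.m i) → ℝ) : Prop where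
  step : ∀ i k, z i (k + 1) = S.A i *ᵥ z i k + S.B i *ᵥ v i k

variable {S}

/-- The restriction of an input sequence to the horizon. -/
def truncate (v : ∀ i, ℕ → Fin (S.m i) → ℝ) : S.InputTraj := fun i js => v i js.1 js.2

/-- The stacked state at stage `k` of a family of state sequences. -/
def stackState (z : ∀ i, ℕ → Fin (S.n i) → ℝ) (k : ℕ) : S.State :=
  WithLp.toLp 2 fun i => WithLp.toLp 2 (z i k)

namespace IsTrajectory

variable {z : ∀ i, ℕ → Fin (S.n i) → ℝ} {v : ∀ i, ℕ → Fin (S.m i) → ℝ}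

theorem predState_eq (h : S.IsTrajectory z v) (i : Fin S.M) (k : Fin (S.N + 1)) :
    S.predState i (z i 0) (truncate v i) k = z i k :=
  S.predState_eq_of_dynamics i (h.step i) k

theorem mem_feasibleGraph_iff (h : S.IsTrajectory z v) :
    (truncate v, stackState z 0) ∈ S.feasibleGraph ↔
      (∀ k < S.N, (∀ i, v i k ∈ S.inputSet i) ∧ (∀ i, z i k ∈ S.stateSet i) ∧
        S.CouplingOK (fun i => z i k) fun i => v i k) ∧ ∀ i, z i S.N ∈ S.terminalSet i := by
  have h1 := couplingMap_le_iff S (truncate v, stackState z 0)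
  simp only [stackState, h.predState_eq] at h1
  simp only [feasibleGraph, localGraph, localSet, Set.mem_ofPred_eq, stackState, h1,
    h.predState_eq]
  constructor
  · rintro ⟨hl, hc⟩
    exact ⟨fun k hk => ⟨fun i => (hl i).1 ⟨k, hk⟩, fun i => (hl i).2.1 ⟨k, hk⟩, hc ⟨k, hk⟩⟩,
      fun i => (hl i).2.2⟩
  · rintro ⟨hs, ht⟩
    exact ⟨fun i => ⟨fun k => (hs k k.2).1 i, fun k => (hs k k.2).2.1 i, ht i⟩,
      fun k => (hs k k.2).2.2⟩

theorem totalCost_eq (h : S.IsTrajectory z v) : S.totalCost (truncate v) (stackState z 0) =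
    ∑ i, (1 / 2) * (wnormSq (S.P i) (z i S.N) +
      ∑ k ∈ Finset.range S.N, (wnormSq (S.Q i) (z i k) + wnormSq (S.R i) (v i k))) := by
  refine Finset.sum_congr rfl fun i _ => ?_
  simp only [localCost, stackState, h.predState_eq, Fin.val_last, Fin.val_castSucc]
  rw [← Fin.sum_univ_eq_sum_range fun k => wnormSq (S.Q i) (z i k) + wnormSq (S.R i) (v i k)]
  rfl

theorem shift (h : S.IsTrajectory z v) :
    S.IsTrajectory (fun i k => z i (k + 1)) (fun i k => v i (k + 1)) :=
  ⟨fun i k => h.step i (k + 1)⟩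

end IsTrajectory

/-- The state sequence of agent `i` under the input trajectory `u` over the horizon and the
terminal feedback `-K x` afterwards. -/
def extState (K : ∀ i, Matrix (Fin (S.m i)) (Fin (S.n i)) ℝ) (u : S.InputTraj) (x : S.State)
    (i : Fin S.M) : ℕ → Fin (S.n i) → ℝ
  | 0 => (x i).ofLp
  | k + 1 => S.A i *ᵥ extState K u x i k + S.B i *ᵥ
      (if h : k < S.N then fun s => u i (⟨k, h⟩, s) else -(K i *ᵥ extState K u x i k))

/-- The input sequence that generates `extState`. -/
def extInput (K : ∀ i, Matrix (Fin (S.m i)) (Fin (S.n i)) ℝ) (u : S.InputTraj) (x : S.State)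
    (i : Fin S.M) (k : ℕ) : Fin (S.m i) → ℝ :=
  if h : k < S.N then fun s => u i (⟨k, h⟩, s) else -(K i *ᵥ extState K u x i k)

section Extension

variable (K : ∀ i, Matrix (Fin (S.m i)) (Fin (S.n i)) ℝ) (u : S.InputTraj) (x : S.State)

theorem isTrajectory_ext : S.IsTrajectory (extState K u x) (extInput K u x) :=
  ⟨fun _ _ => rfl⟩

theorem truncate_extInput : truncate (extInput K u x) = u := by
  funext i js
  simp [truncate, extInput]

theorem stackState_extState : stackState (extState K u x) 0 = x := rfl

theorem extInput_of_le (i : Fin S.M) {k : ℕ} (hk : S.N ≤ k) :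
    extInput K u x i k = -(K i *ᵥ extState K u x i k) := by
  simp [extInput, hk.not_gt]

theorem extState_succ_of_le (i : Fin S.M) {k : ℕ} (hk : S.N ≤ k) :
    extState K u x i (k + 1) = (S.A i - S.B i * K i) *ᵥ extState K u x i k := by
  rw [(isTrajectory_ext K u x).step, extInput_of_le K u x i hk, mulVec_neg, mulVec_mulVec,
    ← sub_eq_add_neg, ← sub_mulVec]

theorem mem_feasibleGraph_iff_ext : (u, x) ∈ S.feasibleGraph ↔
    (∀ k < S.N, (∀ i, extInput K u x i k ∈ S.inputSet i) ∧
      (∀ i, extState K u x i k ∈ S.stateSet i) ∧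
      S.CouplingOK (fun i => extState K u x i k) fun i => extInput K u x i k) ∧
    ∀ i, extState K u x i S.N ∈ S.terminalSet i := by
  have := (isTrajectory_ext K u x).mem_feasibleGraph_iff
  rwa [truncate_extInput, stackState_extState] at this

end Extension

theorem mem_feasibleSet_iff {x : S.State} : x ∈ S.feasibleSet ↔ ∃ u, (u, x) ∈ S.feasibleGraph := by
  -- The inputs beyond the horizon play no role here.
  let K : ∀ i, Matrix (Fin (S.m i)) (Fin (S.n i)) ℝ := fun _ => 0
  have key := fun u => mem_feasibleGraph_iff_ext K u x
  constructor
  · rintro ⟨ξ, ν, h⟩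
    let u : S.InputTraj := fun i js => ν i js.1 js.2
    have hξ : ∀ i (k : ℕ) (hk : k < S.N + 1), extState K u x i k = ξ i ⟨k, hk⟩ := by
      intro i k
      induction k with
      | zero => exact fun hk => (h.initial i).symm
      | succ k ih =>
        intro hk
        have := h.dynamics i ⟨k, by omega⟩
        rw [Fin.succ_mk, Fin.castSucc_mk] at this
        rw [this, (isTrajectory_ext K u x).step, ih (by omega)]
        simp [extInput, u, Nat.lt_of_succ_lt_succ hk]
    have hν : ∀ i (k : ℕ) (hk : k < S.N), extInput K u x i k = ν i ⟨k, hk⟩ := by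
      intro i k hk
      simp [extInput, u, hk]
    refine ⟨u, (key u).2 ⟨fun k hk => ⟨fun i => ?_, fun i => ?_, ?_⟩, fun i => ?_⟩⟩
    · rw [hν i k hk]; exact h.input i _
    · rw [hξ i k (by omega)]; exact h.state i ⟨k, hk⟩
    · have := h.coupling ⟨k, hk⟩
      convert this using 2
      · exact hξ _ k (by omega)
      · exact hν _ k hk
    · rw [hξ i S.N (by omega)]; exact h.terminal i
  · rintro ⟨u, hu⟩
    obtain ⟨hs, ht⟩ := (key u).1 hu
    exact ⟨fun i k => extState K u x i k, fun i k => extInput K u x i k,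
      fun i k => (isTrajectory_ext K u x).step i k, fun i => rfl, ht,
      fun i k => (hs k k.2).1 i, fun i k => (hs k k.2).2.1 i, fun k => (hs k k.2).2.2⟩

/-- States in the terminal sets are feasible: the terminal feedback is admissible from there. -/
theorem mem_feasibleSet_of_terminalSet {K : ∀ i, Matrix (Fin (S.m i)) (Fin (S.n i)) ℝ}
    (hK : S.TerminalIngredients K) {x : S.State} (hx : ∀ i, (x i).ofLp ∈ S.terminalSet i) :
    x ∈ S.feasibleSet := by
  let z : ∀ i, ℕ → Fin (S.n i) → ℝ := fun i k => ((S.A i - S.B i * K i) ^ k) *ᵥ (x i).ofLp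
  have hstep : ∀ i k, z i (k + 1) = (S.A i - S.B i * K i) *ᵥ z i k := fun i k => by
    simp only [z, mulVec_mulVec, pow_succ']
  have hz : ∀ k i, z i k ∈ S.terminalSet i := by
    intro k i
    induction k with
    | zero => simpa [z] using hx i
    | succ k ih => rw [hstep]; exact hK.invariant i _ ih
  have htraj : S.IsTrajectory z (fun i k => -(K i *ᵥ z i k)) := ⟨fun i k => by
    rw [hstep, sub_mulVec, mulVec_neg, ← mulVec_mulVec _ (S.B i), ← sub_eq_add_neg]⟩
  have hz0 : stackState z 0 = x := by
    simp [stackState, z]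
  refine mem_feasibleSet_iff.2 ⟨truncate fun i k => -(K i *ᵥ z i k), ?_⟩
  rw [← hz0]
  exact htraj.mem_feasibleGraph_iff.2
    ⟨fun k _ => ⟨fun i => hK.input_admissible i _ (hz k i),
      fun i => hK.state_admissible i (hz k i), hK.coupling_admissible _ (hz k)⟩, hz _⟩

theorem wnormSq_nonneg {n : ℕ} {W : Matrix (Fin n) (Fin n) ℝ} (hW : W.PosDef) (x : Fin n → ℝ) :
    0 ≤ wnormSq W x := by
  simpa [wnormSq] using hW.posSemidef.dotProduct_mulVec_nonneg x

/-- The stacked first-stage input of an input trajectory. -/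
def firstInput : S.InputTraj →ₗ[ℝ] S.Input where
  toFun u := WithLp.toLp 2 fun i => WithLp.toLp 2 fun s => u i (⟨0, S.N_pos⟩, s)
  map_add' _ _ := rfl
  map_smul' _ _ := rfl

/-- Recursive feasibility and decrease of the cost: the tail of a feasible trajectory, continued by
the terminal feedback, is feasible for the successor state, and it is cheaper by at least the state
cost at the first stage. -/
theorem exists_successor (hS : S.StandingAssumption) {u : S.InputTraj} {x : S.State}
    (hu : (u, x) ∈ S.feasibleGraph) :
    ∃ u', (u', S.plant x (firstInput u) 0) ∈ S.feasibleGraph ∧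
      S.totalCost u' (S.plant x (firstInput u) 0) ≤
        S.totalCost u x - ∑ i, (1 / 2) * wnormSq (S.Q i) (x i).ofLp := by
  obtain ⟨K, hK⟩ := hS.terminal
  set z := extState K u x with hz
  set v := extInput K u x with hv
  have ht : S.IsTrajectory z v := isTrajectory_ext K u x
  have hmem := mem_feasibleGraph_iff_ext K u x
  have hcost := ht.totalCost_eq
  have hcost' := ht.shift.totalCost_eq
  rw [hv, truncate_extInput, hz, stackState_extState, ← hv, ← hz] at hcost
  obtain ⟨hs, hN⟩ := hmem.1 hu
  have hN1 : ∀ i, z i (S.N + 1) ∈ S.terminalSet i := fun i => by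
    rw [hz, extState_succ_of_le K u x i le_rfl]
    exact hK.invariant i _ (hN i)
  have hvN : ∀ i, v i S.N = -(K i *ᵥ z i S.N) := fun i => extInput_of_le K u x i le_rfl
  have hnext : stackState (fun i k => z i (k + 1)) 0 = S.plant x (firstInput u) 0 := by
    have h1 : ∀ i, v i 0 = fun s => u i (⟨0, S.N_pos⟩, s) := fun i => by
      simp [hv, extInput, S.N_pos]
    simp only [stackState, plant, firstInput, ht.step, zero_add, h1]
    simp [hz, extState]
    rfl
  rw [hnext] at hcost'
  refine ⟨truncate fun i k => v i (k + 1), ?_, ?_⟩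
  · rw [← hnext]
    refine ht.shift.mem_feasibleGraph_iff.2 ⟨fun k hk => ?_, hN1⟩
    rcases Nat.lt_or_ge (k + 1) S.N with h | h
    · exact hs (k + 1) h
    · have hkN : k + 1 = S.N := by omega
      simp only [hkN, hvN]
      exact ⟨fun i => hK.input_admissible i _ (hN i), fun i => hK.state_admissible i (hN i),
        hK.coupling_admissible _ hN⟩
  · rw [hcost', hcost, ← Finset.sum_sub_distrib]
    refine Finset.sum_le_sum fun i _ => ?_
    have hdec := hK.decrease i (z i S.N)
    rw [← extState_succ_of_le K u x i le_rfl, ← hz] at hdec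
    have hQR : wnormSq (S.Q i + (K i)ᵀ * S.R i * K i) (z i S.N) =
        wnormSq (S.Q i) (z i S.N) + wnormSq (S.R i) (v i S.N) := by
      rw [hvN]
      simp only [wnormSq, add_mulVec, dotProduct_add, mulVec_neg, dotProduct_neg, neg_dotProduct,
        neg_neg, ← mulVec_mulVec]
      rw [dotProduct_mulVec _ (K i)ᵀ, vecMul_transpose]
    have hR0 := wnormSq_nonneg (hS.R_posDef i) (v i 0)
    have hshift := Finset.sum_range_succ' (fun k => wnormSq (S.Q i) (z i k) + wnormSq (S.R i) (v i k))
      S.N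
    rw [Finset.sum_range_succ] at hshift
    have hz0 : z i 0 = (x i).ofLp := rfl
    rw [hz0] at hshift
    rw [hQR] at hdec
    linarith

end MPCProblem

/-! ### The total cost as a squared norm -/

open scoped MatrixOrder Matrix.Norms.L2Operator in
theorem Matrix.PosDef.exists_wnormSq_eq {n : ℕ} {W : Matrix (Fin n) (Fin n) ℝ} (hW : W.PosDef) :
    ∃ D : Matrix (Fin n) (Fin n) ℝ, ∀ x, wnormSq W x = ∑ r, (D *ᵥ x) r ^ 2 := by
  obtain ⟨D, rfl⟩ := CStarAlgebra.nonneg_iff_eq_star_mul_self.mp hW.posSemidef.nonneg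
  refine ⟨D, fun x => ?_⟩
  rw [wnormSq, star_eq_conjTranspose, conjTranspose_eq_transpose_of_trivial, ← mulVec_mulVec,
    dotProduct_mulVec, vecMul_transpose]
  simp [dotProduct, sq]

namespace MPCProblem

variable (S : MPCProblem)

/-- The predicted state of agent `i` at stage `k`, as a linear map. -/
def predMap (i : Fin S.M) (k : Fin (S.N + 1)) :
    S.InputTraj × S.State →ₗ[ℝ] Fin (S.n i) → ℝ where
  toFun w := S.predState i (w.2 i).ofLp (w.1 i) k
  map_add' w w' := by
    ext r
    simp only [predState, Prod.fst_add, Prod.snd_add, PiLp.add_apply, WithLp.ofLp_add,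
      Pi.add_apply, mulVec_add]
    ring
  map_smul' c w := by
    ext r
    simp only [predState, Prod.smul_fst, Prod.smul_snd, PiLp.smul_apply, WithLp.ofLp_smul,
      Pi.smul_apply, mulVec_smul, RingHom.id_apply, Pi.add_apply, smul_add]

/-- The input of agent `i` at stage `k`, as a linear map. -/
def stageInputMap (i : Fin S.M) (k : Fin S.N) :
    S.InputTraj × S.State →ₗ[ℝ] Fin (S.m i) → ℝ where
  toFun w s := w.1 i (k, s)
  map_add' _ _ := rfl
  map_smul' _ _ := rfl

theorem isPolyhedral_localGraph : IsPolyhedral S.localGraph := by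
  refine .forall_mem (C := fun i => {w : S.InputTraj × S.State | w.1 i ∈ S.localSet i (w.2 i).ofLp}) fun i => ?_
  exact (IsPolyhedral.forall_mem fun k : Fin S.N =>
      (IsPolyhedral.setOf_map_le (S.Cu i).mulVecLin (S.cu i)).preimage (S.stageInputMap i k)).inter
    ((IsPolyhedral.forall_mem fun k : Fin S.N =>
      (IsPolyhedral.setOf_map_le (S.Cx i).mulVecLin (S.cx i)).preimage
        (S.predMap i k.castSucc)).inter
      ((IsPolyhedral.setOf_map_le (S.CN i).mulVecLin (S.cN i)).preimage
        (S.predMap i (Fin.last S.N))))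

theorem isPolyhedral_feasibleGraph : IsPolyhedral S.feasibleGraph :=
  S.isPolyhedral_localGraph.inter (.setOf_map_le _ _)

/-- The index type of the weighted final states, stage states and stage inputs. -/
abbrev CostIndex : Type := Σ i : Fin S.M, Fin (S.n i) ⊕ (Fin S.N × (Fin (S.n i) ⊕ Fin (S.m i)))

variable {S}

theorem exists_costMap (hS : S.StandingAssumption) :
    ∃ L : S.InputTraj × S.State →ₗ[ℝ] EuclideanSpace ℝ S.CostIndex,
      ∀ w, ‖L w‖ ^ 2 = 2 * S.totalCost w.1 w.2 := by
  choose DQ hQ using fun i => (hS.Q_posDef i).exists_wnormSq_eq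
  choose DR hR using fun i => (hS.R_posDef i).exists_wnormSq_eq
  choose DP hP using fun i => (hS.P_posDef i).exists_wnormSq_eq
  refine ⟨(WithLp.linearEquiv 2 ℝ (S.CostIndex → ℝ)).symm.toLinearMap ∘ₗ LinearMap.pi fun j =>
    match j with
    | ⟨i, .inl r⟩ => LinearMap.proj r ∘ₗ (DP i).mulVecLin ∘ₗ S.predMap i (Fin.last _)
    | ⟨i, .inr (k, .inl r)⟩ => LinearMap.proj r ∘ₗ (DQ i).mulVecLin ∘ₗ S.predMap i k.castSucc
    | ⟨i, .inr (k, .inr r)⟩ => LinearMap.proj r ∘ₗ (DR i).mulVecLin ∘ₗ S.stageInputMap i k,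
    fun w => ?_⟩
  rw [EuclideanSpace.real_norm_sq_eq, Fintype.sum_sigma, totalCost, Finset.mul_sum]
  refine Finset.sum_congr rfl fun i _ => ?_
  rw [localCost, Fintype.sum_sum_type, Fintype.sum_prod_type]
  simp only [Fintype.sum_sum_type, hP, hQ, hR]
  rw [← mul_assoc, mul_one_div_cancel two_ne_zero, one_mul]
  rfl

theorem wnormSq_pos {n : ℕ} {W : Matrix (Fin n) (Fin n) ℝ} (hW : W.PosDef) {x : Fin n → ℝ}
    (hx : x ≠ 0) : 0 < wnormSq W x := by
  simpa [wnormSq] using hW.dotProduct_mulVec_pos hx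

theorem predState_zero (i : Fin S.M) (x : Fin (S.n i) → ℝ) (u : Fin S.N × Fin (S.m i) → ℝ) :
    S.predState i x u 0 = x := by
  simp [predState_apply]

theorem localCost_ge (hS : S.StandingAssumption) (i : Fin S.M) (u : Fin S.N × Fin (S.m i) → ℝ)
    (x : Fin (S.n i) → ℝ) :
    (1 / 2) * (wnormSq (S.Q i) x + ∑ k : Fin S.N, wnormSq (S.R i) fun s => u (k, s)) ≤
      S.localCost i u x := by
  have h1 := wnormSq_nonneg (hS.P_posDef i) (S.predState i x u (Fin.last S.N))
  have h2 : wnormSq (S.Q i) x ≤ ∑ k : Fin S.N, wnormSq (S.Q i) (S.predState i x u k.castSucc) := by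
    have := Finset.single_le_sum (f := fun k : Fin S.N =>
      wnormSq (S.Q i) (S.predState i x u k.castSucc))
      (fun k _ => wnormSq_nonneg (hS.Q_posDef i) _) (Finset.mem_univ ⟨0, S.N_pos⟩)
    have h0 : (⟨0, S.N_pos⟩ : Fin S.N).castSucc = 0 := rfl
    rwa [h0, predState_zero] at this
  rw [localCost, Finset.sum_add_distrib]
  linarith

/-- The cost vanishes only at the origin: it bounds the measured state and every input. -/
theorem eq_zero_of_totalCost_eq_zero (hS : S.StandingAssumption) (w : S.InputTraj × S.State)
    (hw : S.totalCost w.1 w.2 = 0) : w = 0 := by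
  have hR : ∀ i (k : Fin S.N), 0 ≤ wnormSq (S.R i) fun s => w.1 i (k, s) :=
    fun i k => wnormSq_nonneg (hS.R_posDef i) _
  have hQ : ∀ i, 0 ≤ wnormSq (S.Q i) (w.2 i).ofLp := fun i => wnormSq_nonneg (hS.Q_posDef i) _
  have hge := fun i => localCost_ge hS i (w.1 i) (w.2 i).ofLp
  have hsum : ∀ i, 0 ≤ ∑ k : Fin S.N, wnormSq (S.R i) fun s => w.1 i (k, s) :=
    fun i => Finset.sum_nonneg fun k _ => hR i k
  have hz : ∀ i, S.localCost i (w.1 i) (w.2 i).ofLp = 0 := fun i =>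
    (Finset.sum_eq_zero_iff_of_nonneg fun i _ => by linarith [hge i, hsum i, hQ i]).1 hw i
      (Finset.mem_univ i)
  refine Prod.ext (funext fun i => funext fun ks => ?_) ?_
  · by_contra hne
    have h1 := wnormSq_pos (hS.R_posDef i) (x := fun s => w.1 i (ks.1, s))
      fun h => hne (congrFun h ks.2)
    have h2 := Finset.single_le_sum (f := fun k : Fin S.N => wnormSq (S.R i) fun s => w.1 i (k, s))
      (fun k _ => hR i k) (Finset.mem_univ ks.1)
    linarith [hge i, hz i, hQ i]
  · ext i r
    by_contra hne
    have h1 := wnormSq_pos (hS.Q_posDef i) (x := (w.2 i).ofLp) fun h => hne (congrFun h r)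
    linarith [hge i, hz i, hsum i]

theorem exists_norm_sq_le_stateCost (hS : S.StandingAssumption) :
    ∃ c : ℝ, 0 < c ∧ ∀ x : S.State, ‖x‖ ^ 2 ≤ c * ∑ i, (1 / 2) * wnormSq (S.Q i) (x i).ofLp := by
  choose DQ hQ using fun i => (hS.Q_posDef i).exists_wnormSq_eq
  let T : S.State →ₗ[ℝ] EuclideanSpace ℝ (Σ i : Fin S.M, Fin (S.n i)) :=
    (WithLp.linearEquiv 2 ℝ ((Σ i : Fin S.M, Fin (S.n i)) → ℝ)).symm.toLinearMap ∘ₗ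
      LinearMap.pi fun j => LinearMap.proj j.2 ∘ₗ (DQ j.1).mulVecLin ∘ₗ S.predMap j.1 0 ∘ₗ
        LinearMap.inr ℝ _ _
  have hT : ∀ x, ‖T x‖ ^ 2 = ∑ i, wnormSq (S.Q i) (x i).ofLp := by
    intro x
    rw [EuclideanSpace.real_norm_sq_eq, Fintype.sum_sigma]
    refine Finset.sum_congr rfl fun i _ => ?_
    rw [hQ]
    refine Finset.sum_congr rfl fun r _ => ?_
    have h0 : S.predMap i 0 (0, x) = (x i).ofLp := predState_zero i _ _
    simp [T, h0]
  obtain ⟨c, hc, h⟩ := T.exists_norm_ge fun x hx => by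
    have h0 := hT x
    rw [hx, norm_zero, zero_pow two_ne_zero, eq_comm, Finset.sum_eq_zero_iff_of_nonneg
      fun i _ => wnormSq_nonneg (hS.Q_posDef i) _] at h0
    ext i r
    by_contra hne
    have h1 := wnormSq_pos (hS.Q_posDef i) (x := (x i).ofLp) fun h => hne (congrFun h r)
    linarith [h0 i (Finset.mem_univ i)]
  refine ⟨2 * c ^ 2, by positivity, fun x => ?_⟩
  rw [← Finset.mul_sum, ← hT]
  calc ‖x‖ ^ 2 ≤ (c * ‖T x‖) ^ 2 := by gcongr; exact h x
    _ = _ := by ring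

end MPCProblem

/-! ### The regularized dual solution and the recovered inputs -/

theorem argminOn_eq {α β : Type*} [Preorder β] [Zero α] {s : Set α} {g : α → β} {a : α}
    (ha : a ∈ s) (hmin : IsMinOn g s a) (huniq : ∀ a' ∈ s, g a' ≤ g a → a' = a) :
    argminOn s g = a := by
  have h : ∃ a ∈ s, IsMinOn g s a := ⟨a, ha, hmin⟩
  rw [argminOn, dif_pos h]
  exact huniq _ h.choose_spec.1 (h.choose_spec.2 ha)

theorem EReal.coe_finsetSum {ι : Type*} (s : Finset ι) (f : ι → ℝ) :
    ((∑ i ∈ s, f i : ℝ) : EReal) = ∑ i ∈ s, (f i : EReal) :=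
  map_sum (⟨⟨fun x : ℝ => (x : EReal), EReal.coe_zero⟩, EReal.coe_add⟩ : ℝ →+ EReal) f s

namespace MPCProblem

variable {S : MPCProblem}

theorem neg_transpose_mulVec_dotProduct (i : Fin S.M) (lam : Fin S.N × Fin S.p → ℝ)
    (u : Fin S.N × Fin (S.m i) → ℝ) :
    (-((S.E i)ᵀ *ᵥ lam)) ⬝ᵥ u = -(lam ⬝ᵥ S.E i *ᵥ u) := by
  rw [neg_dotProduct, mulVec_transpose, ← dotProduct_mulVec]

theorem le_fenchelConj_h (i : Fin S.M) (lam : Fin S.N × Fin S.p → ℝ) (x : Fin (S.n i) → ℝ)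
    {u : Fin S.N × Fin (S.m i) → ℝ} (hu : u ∈ S.localSet i x) :
    ((-(S.localCost i u x + lam ⬝ᵥ S.E i *ᵥ u) : ℝ) : EReal) ≤
      fenchelConj (S.h i x) (-((S.E i)ᵀ *ᵥ lam)) := by
  refine le_trans (le_of_eq ?_) (le_iSup _ u)
  rw [h, indicatorFn, if_pos hu, add_zero, neg_transpose_mulVec_dotProduct, ← EReal.coe_sub]
  congr 1
  ring

theorem fenchelConj_h_le (i : Fin S.M) (lam : Fin S.N × Fin S.p → ℝ) (x : Fin (S.n i) → ℝ) {c : ℝ}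
    (hc : ∀ u ∈ S.localSet i x, c ≤ S.localCost i u x + lam ⬝ᵥ S.E i *ᵥ u) :
    fenchelConj (S.h i x) (-((S.E i)ᵀ *ᵥ lam)) ≤ ((-c : ℝ) : EReal) := by
  refine iSup_le fun u => ?_
  rw [h, indicatorFn]
  split_ifs with hu
  · rw [add_zero, neg_transpose_mulVec_dotProduct, ← EReal.coe_sub, EReal.coe_le_coe_iff]
    linarith [hc u hu]
  · rw [EReal.coe_add_top, EReal.sub_top]
    exact bot_le

theorem le_fenchelConj_couplingSet {x : S.State} (lam : Fin S.N × Fin S.p → ℝ)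
    {y : Fin S.N × Fin S.p → ℝ} (hy : y ∈ S.couplingSet x) :
    ((lam ⬝ᵥ y : ℝ) : EReal) ≤ fenchelConj (indicatorFn (S.couplingSet x)) lam := by
  refine le_trans (le_of_eq ?_) (le_iSup _ y)
  rw [indicatorFn, if_pos hy, sub_zero]

theorem fenchelConj_couplingSet_le {x : S.State} {lam : Fin S.N × Fin S.p → ℝ} (hlam : 0 ≤ lam) :
    fenchelConj (indicatorFn (S.couplingSet x)) lam ≤
      ((lam ⬝ᵥ (S.b - ∑ i, S.F i *ᵥ (x i).ofLp) : ℝ) : EReal) := by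
  refine iSup_le fun y => ?_
  rw [indicatorFn]
  split_ifs with hy
  · rw [sub_zero, EReal.coe_le_coe_iff]
    exact dotProduct_le_dotProduct_of_nonneg_left (le_sub_iff_add_le'.2 hy) hlam
  · rw [EReal.sub_top]
    exact bot_le

variable {L : S.InputTraj × S.State →ₗ[ℝ] EuclideanSpace ℝ S.CostIndex} {ε : ℝ} {x : S.State}
  {u : S.InputTraj} {lam : Fin S.N × Fin S.p → ℝ}

/-- The stationarity condition decouples over the agents: varying one component of `u` at a time
shows that `u i` minimizes the Lagrangian of agent `i`, with a quadratic margin. -/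
theorem localCost_add_le_of_isPenaltyKKT (hL : ∀ w, ‖L w‖ ^ 2 = 2 * S.totalCost w.1 w.2)
    (hk : IsPenaltyKKT L S.localGraph S.couplingMap S.b ε x u lam) (i : Fin S.M)
    {v : Fin S.N × Fin (S.m i) → ℝ} (hv : v ∈ S.localSet i (x i).ofLp) :
    S.localCost i (u i) (x i).ofLp + lam ⬝ᵥ S.E i *ᵥ u i +
        (1 / 2) * ‖L (Function.update u i v - u, 0)‖ ^ 2 ≤
      S.localCost i v (x i).ofLp + lam ⬝ᵥ S.E i *ᵥ v := by
  set u' := Function.update u i v with hu'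
  have hne : ∀ j, j ≠ i → u' j = u j := fun j hj => Function.update_of_ne hj _ _
  have hii : u' i = v := Function.update_self _ _ _
  have hmem : (u', x) ∈ S.localGraph := by
    intro j
    by_cases hj : j = i
    · subst hj; simpa only [hii] using hv
    · simp only [hne j hj]; exact hk.mem j
  have hst := hk.stationary u' hmem
  have hcost : S.totalCost u' x - S.totalCost u x =
      S.localCost i v (x i).ofLp - S.localCost i (u i) (x i).ofLp := by
    rw [totalCost, totalCost, ← Finset.sum_sub_distrib, Finset.sum_eq_single i, hii]
    · intro j _ hj; rw [hne j hj, sub_self]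
    · simp
  have hG : S.couplingMap (u' - u, 0) = S.E i *ᵥ v - S.E i *ᵥ u i := by
    rw [couplingMap_apply, Finset.sum_eq_single i]
    · simp [hii, mulVec_sub]
    · intro j _ hj; simp [hne j hj]
    · simp
  have hsq : ‖L (u', x)‖ ^ 2 = ‖L (u, x)‖ ^ 2 + 2 * inner ℝ (L (u, x)) (L (u' - u, 0)) +
      ‖L (u' - u, 0)‖ ^ 2 := by
    rw [← norm_add_sq_real, ← map_add]; simp
  rw [hG, dotProduct_sub] at hst
  have h1 := hL (u', x)
  have h2 := hL (u, x)
  simp only at h1 h2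
  linarith

theorem primalRecovery_eq_of_isPenaltyKKT (hL : ∀ w, ‖L w‖ ^ 2 = 2 * S.totalCost w.1 w.2)
    (hL0 : ∀ w, L w = 0 → w = 0)
    (hk : IsPenaltyKKT L S.localGraph S.couplingMap S.b ε x u lam) (i : Fin S.M) :
    S.primalRecovery i lam (x i).ofLp = u i := by
  refine argminOn_eq (hk.mem i) ?_ ?_
  · intro v hv
    have := localCost_add_le_of_isPenaltyKKT hL hk i hv
    rw [Set.mem_ofPred_eq]
    nlinarith [sq_nonneg ‖L (Function.update u i v - u, 0)‖]
  · intro v hv hle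
    have := localCost_add_le_of_isPenaltyKKT hL hk i hv
    have h0 : ‖L (Function.update u i v - u, 0)‖ ^ 2 ≤ 0 := by linarith
    have h1 : L (Function.update u i v - u, 0) = 0 := by
      rw [← norm_eq_zero]
      exact pow_eq_zero_iff two_ne_zero |>.1 (le_antisymm h0 (sq_nonneg _))
    have h2 := congrFun (congrArg Prod.fst (hL0 _ h1)) i
    simpa [sub_eq_zero] using h2

/-- The multiplier of the penalized problem is the unique minimizer of the regularized dual. The
lower bound for the dual cost comes from testing the support function of the coupling set at the
single point `∑ E^i u^i - 2 ε lam`. -/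
theorem dualSol_eq_of_isPenaltyKKT (hε : 0 < ε) (hL : ∀ w, ‖L w‖ ^ 2 = 2 * S.totalCost w.1 w.2)
    (hk : IsPenaltyKKT L S.localGraph S.couplingMap S.b ε x u lam) : S.dualSol ε x = lam := by
  set e := ∑ i, S.E i *ᵥ u i with he
  set f := ∑ i, S.F i *ᵥ (x i).ofLp with hf
  have hG : S.couplingMap (u, x) = f + e := by
    rw [couplingMap_apply, Finset.sum_add_distrib]
  have hsum : ∀ μ : Fin S.N × Fin S.p → ℝ,
      ∑ i, -(S.localCost i (u i) (x i).ofLp + μ ⬝ᵥ S.E i *ᵥ u i) =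
        -(S.totalCost u x + μ ⬝ᵥ e) := by
    intro μ
    rw [he, dotProduct_sum, totalCost, ← Finset.sum_add_distrib, Finset.sum_neg_distrib]
  have hy : e - (2 * ε) • lam ∈ S.couplingSet x := by
    have := hk.violation_le
    rw [hG] at this
    intro k
    have := this k
    simp only [Pi.sub_apply, Pi.add_apply] at this ⊢
    linarith
  have hlow : ∀ μ, ((-(S.totalCost u x) + ε * (μ ⬝ᵥ μ) - 2 * ε * (μ ⬝ᵥ lam) : ℝ) : EReal) ≤
      S.dualCost ε x μ := by
    intro μ
    have h1 := Finset.sum_le_sum fun i (_ : i ∈ Finset.univ) =>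
      le_fenchelConj_h i μ (x i).ofLp (hk.mem i)
    rw [← EReal.coe_finsetSum, hsum] at h1
    refine le_trans (le_of_eq ?_) (add_le_add (add_le_add_left h1 _)
      (le_fenchelConj_couplingSet μ hy))
    rw [← EReal.coe_add, ← EReal.coe_add]
    congr 1
    rw [dotProduct_sub, dotProduct_smul, smul_eq_mul]
    ring
  have hup : S.dualCost ε x lam ≤ ((-(S.totalCost u x) - ε * (lam ⬝ᵥ lam) : ℝ) : EReal) := by
    have h1 := Finset.sum_le_sum fun i (_ : i ∈ Finset.univ) =>
      fenchelConj_h_le i lam (x i).ofLp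
        (c := S.localCost i (u i) (x i).ofLp + lam ⬝ᵥ S.E i *ᵥ u i) fun v hv => by
          have := localCost_add_le_of_isPenaltyKKT hL hk i hv
          nlinarith [sq_nonneg ‖L (Function.update u i v - u, 0)‖]
    rw [← EReal.coe_finsetSum, hsum] at h1
    refine le_trans (add_le_add (add_le_add_left h1 _)
      (fenchelConj_couplingSet_le hk.nonneg)) (le_of_eq ?_)
    rw [← EReal.coe_add, ← EReal.coe_add]
    congr 1
    have hs := hk.slack
    rw [hG, dotProduct_sub, dotProduct_add] at hs
    rw [dotProduct_sub, ← hf]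
    linarith
  have hsq : ∀ μ : Fin S.N × Fin S.p → ℝ, (μ - lam) ⬝ᵥ (μ - lam) =
      μ ⬝ᵥ μ - 2 * (μ ⬝ᵥ lam) + lam ⬝ᵥ lam := by
    intro μ
    rw [sub_dotProduct, dotProduct_sub, dotProduct_sub, dotProduct_comm lam μ]
    ring
  have hnn : ∀ y : Fin S.N × Fin S.p → ℝ, 0 ≤ y ⬝ᵥ y := fun y =>
    Finset.sum_nonneg fun k _ => mul_self_nonneg _
  refine argminOn_eq (Set.mem_univ _) (fun μ _ => ?_) fun μ _ hμ => ?_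
  · refine hup.trans (le_trans ?_ (hlow μ))
    rw [EReal.coe_le_coe_iff]
    nlinarith [hsq μ, hnn (μ - lam)]
  · have h1 := (hlow μ).trans (hμ.trans hup)
    rw [EReal.coe_le_coe_iff] at h1
    have h2 : (μ - lam) ⬝ᵥ (μ - lam) = 0 := by
      refine le_antisymm ?_ (hnn _)
      rw [hsq]
      nlinarith
    exact sub_eq_zero.1 (dotProduct_self_eq_zero.1 h2)

theorem kappa_eq_of_isPenaltyKKT (hε : 0 < ε) (hL : ∀ w, ‖L w‖ ^ 2 = 2 * S.totalCost w.1 w.2)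
    (hL0 : ∀ w, L w = 0 → w = 0)
    (hk : IsPenaltyKKT L S.localGraph S.couplingMap S.b ε x u lam) :
    S.kappa ε x = firstInput u := by
  rw [kappa, dualSol_eq_of_isPenaltyKKT hε hL hk]
  simp only [q, primalRecovery_eq_of_isPenaltyKKT hL hL0 hk]
  rfl

end MPCProblem

/-! ### The value function as a Lyapunov function -/

theorem IsPolyhedral.exists_fibre_min {U X H : Type} [NormedAddCommGroup U] [NormedSpace ℝ U]
    [FiniteDimensional ℝ U] [NormedAddCommGroup X] [NormedSpace ℝ X] [FiniteDimensional ℝ X]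
    [NormedAddCommGroup H] [InnerProductSpace ℝ H] [CompleteSpace H] {L : U × X →ₗ[ℝ] H}
    (hL : ∀ w, L w = 0 → w = 0) {C : Set (U × X)} (hC : IsPolyhedral C) {x : X} {u : U}
    (hu : (u, x) ∈ C) :
    ∃ w, (w, x) ∈ C ∧ ∀ v, (v, x) ∈ C → 0 ≤ inner ℝ (L (w, x)) (L (v - w, 0)) := by
  have hconv : Convex ℝ {v | (v, x) ∈ C} := by
    intro p hp q hq a c ha hc hac
    have := hC.convex (x := (p, x)) hp (y := (q, x)) hq ha hc hac
    have hx : a • x + c • x = x := by rw [← add_smul, hac, one_smul]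
    simpa [hx] using this
  have hcl : IsClosed {v | (v, x) ∈ C} :=
    hC.isClosed.preimage (f := fun v => (v, x)) (by fun_prop)
  obtain ⟨w, hw, hvar⟩ := exists_variational_min (L ∘ₗ LinearMap.inl ℝ U X)
    (fun v hv => by simpa using congrArg Prod.fst (hL _ hv)) (L (0, x)) ⟨u, hu⟩ hconv hcl
  refine ⟨w, hw, fun v hv => ?_⟩
  have := hvar v hv
  simp only [LinearMap.comp_apply, LinearMap.inl_apply] at this
  rwa [← map_add, Prod.mk_add_mk, zero_add, add_zero] at this

theorem norm_map_le_of_inner_nonneg {U X H : Type} [AddCommGroup U] [Module ℝ U]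
    [AddCommGroup X] [Module ℝ X] [NormedAddCommGroup H] [InnerProductSpace ℝ H]
    {L : U × X →ₗ[ℝ] H} {w v : U} {x : X} (h : 0 ≤ inner ℝ (L (w, x)) (L (v - w, 0))) :
    ‖L (w, x)‖ ≤ ‖L (v, x)‖ := by
  have hsq : ‖L (v, x)‖ ^ 2 = ‖L (w, x)‖ ^ 2 + 2 * inner ℝ (L (w, x)) (L (v - w, 0)) +
      ‖L (v - w, 0)‖ ^ 2 := by
    rw [← norm_add_sq_real, ← map_add]; simp
  refine le_of_sq_le_sq ?_ (norm_nonneg _)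
  nlinarith [sq_nonneg ‖L (v - w, 0)‖]

namespace MPCProblem

variable {S : MPCProblem}

variable (S) in
/-- The effect of the inputs on the successor state. -/
def inputMap : S.Input →ₗ[ℝ] S.State where
  toFun u := WithLp.toLp 2 fun i => WithLp.toLp 2 (S.B i *ᵥ (u i).ofLp)
  map_add' u v := by
    ext i r
    simp [mulVec_add]
  map_smul' c u := by
    ext i r
    simp [mulVec_smul]

theorem plant_eq_add (x : S.State) (u v : S.Input) (d : S.State) :
    S.plant x u d = S.plant x v 0 + (S.inputMap (u - v) + d) := by
  ext i r
  simp only [plant, inputMap, LinearMap.coe_mk, AddHom.coe_mk, PiLp.add_apply, PiLp.sub_apply,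
    PiLp.zero_apply, WithLp.ofLp_sub, Pi.add_apply, mulVec_sub, Pi.sub_apply]
  ring

theorem zero_mem_feasibleGraph (hS : S.StandingAssumption) :
    ((0, 0) : S.InputTraj × S.State) ∈ S.feasibleGraph := by
  obtain ⟨K, hK⟩ := hS.terminal
  have hX := fun i => interior_subset (hS.zero_mem_interior_terminalSet i)
  have ht : S.IsTrajectory (fun _ _ => 0) (fun _ _ => 0) := ⟨by simp⟩
  refine ht.mem_feasibleGraph_iff.2 ⟨fun k _ => ⟨fun i => ?_, fun i => ?_, ?_⟩, hX⟩
  · exact interior_subset (hS.zero_mem_interior_inputSet i)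
  · exact interior_subset (hS.zero_mem_interior_stateSet i)
  · simpa using hK.coupling_admissible _ hX

theorem exists_ball_subset_feasibleSet (hS : S.StandingAssumption) :
    ∃ r : ℝ, 0 < r ∧ ∀ x : S.State, ‖x‖ ≤ r → x ∈ S.feasibleSet := by
  obtain ⟨K, hK⟩ := hS.terminal
  have hev : ∀ᶠ x : S.State in 𝓝 0, ∀ i, (x i).ofLp ∈ S.terminalSet i := by
    rw [eventually_all]
    intro i
    have hc : Continuous fun x : S.State => (x i).ofLp := by fun_prop
    exact hc.continuousAt.eventually_mem (mem_interior_iff_mem_nhds.1 (by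
      simpa using hS.zero_mem_interior_terminalSet i))
  obtain ⟨r, hr, h⟩ := Metric.eventually_nhds_iff_ball.1 hev
  refine ⟨r / 2, by positivity, fun x hx => mem_feasibleSet_of_terminalSet hK (h x ?_)⟩
  rw [mem_ball_zero_iff]
  linarith

/-- The square root of the value function of the constrained problem, up to a factor, is an ISS
Lyapunov function on the feasible set for the plant under the regularized law, uniformly in the
regularization parameter. It is comparable to the norm, contracts along the exact law, and is
Lipschitz by the Lipschitz dependence of the feasible inputs on the state; the regularized law is a
relative perturbation of size `O(√ε)` of the exact one. -/
theorem exists_issLyapunov (hS : S.StandingAssumption) :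
    ∃ (V : S.State → ℝ) (c₀ c₁ c₂ γ θ εt : ℝ), 0 < c₀ ∧ 0 < c₁ ∧ 0 < c₂ ∧ 0 < γ ∧ 0 < θ ∧ θ < 1 ∧
      0 < εt ∧ (∀ x, 0 ≤ V x) ∧ (∀ x ∈ S.feasibleSet, ‖x‖ ≤ c₁ * V x) ∧
      (∀ x ∈ S.feasibleSet, V x ≤ c₀ * ‖x‖) ∧
      ∀ ε, 0 < ε → ε ≤ εt → ∀ x ∈ S.feasibleSet, ∀ (δ : S.Input) (d : S.State),
        ‖S.plant x (S.kappa ε x + δ) d‖ ≤ c₂ * (V x + (‖δ‖ + ‖d‖)) ∧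
        (S.plant x (S.kappa ε x + δ) d ∈ S.feasibleSet →
          V (S.plant x (S.kappa ε x + δ) d) ≤ θ * V x + γ * (‖δ‖ + ‖d‖)) := by
  classical
  obtain ⟨L, hL⟩ := exists_costMap hS
  have hL0 : ∀ w, L w = 0 → w = 0 := fun w hw => by
    have h := hL w
    rw [hw, norm_zero] at h
    exact eq_zero_of_totalCost_eq_zero hS w (by linarith)
  have hex : ∀ x, ∃ w, x ∈ S.feasibleSet → (w, x) ∈ S.feasibleGraph ∧
      ∀ v, (v, x) ∈ S.feasibleGraph → 0 ≤ inner ℝ (L (w, x)) (L (v - w, 0)) := by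
    intro x
    by_cases hx : x ∈ S.feasibleSet
    · obtain ⟨u, hu⟩ := mem_feasibleSet_iff.1 hx
      obtain ⟨w, hw⟩ := S.isPolyhedral_feasibleGraph.exists_fibre_min hL0 hu
      exact ⟨w, fun _ => hw⟩
    · exact ⟨0, fun h => absurd h hx⟩
  choose w hw using hex
  obtain ⟨cl, hcl, hlip⟩ := S.isPolyhedral_feasibleGraph.exists_lipschitz_fibres
  obtain ⟨cL, hcL, hLle⟩ := L.exists_norm_le
  obtain ⟨c₁, hc₁, hLge⟩ := L.exists_norm_ge hL0
  obtain ⟨ce, hce, herr⟩ := IsPenaltyKKT.exists_error_bound hL0 S.isPolyhedral_localGraph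
    S.couplingMap S.b
  obtain ⟨cB, hcB, hB⟩ := S.inputMap.exists_norm_le
  obtain ⟨cF, hcF, hF⟩ := (S.inputMap ∘ₗ firstInput).exists_norm_le
  obtain ⟨cQ, hcQ, hQ⟩ := exists_norm_sq_le_stateCost hS
  set V : S.State → ℝ := fun x => ‖L (w x, x)‖
  have hVw : ∀ x, ‖L (w x, x)‖ = V x := fun x => rfl
  have hV0 : ∀ x, 0 ≤ V x := fun x => norm_nonneg _
  have hVmin : ∀ x ∈ S.feasibleSet, ∀ v, (v, x) ∈ S.feasibleGraph → V x ≤ ‖L (v, x)‖ :=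
    fun x hx v hv => norm_map_le_of_inner_nonneg ((hw x hx).2 v hv)
  clear_value V
  obtain ⟨c', hc'⟩ : ∃ c' : ℝ, c' = cL * (cl + 1) := ⟨_, rfl⟩
  have hc'0 : 0 < c' := by rw [hc']; positivity
  -- The feasible inputs at one state can be moved to another at a cost proportional to the distance.
  have hVlip : ∀ y u x, (u, y) ∈ S.feasibleGraph → x ∈ S.feasibleSet →
      V x ≤ ‖L (u, y)‖ + c' * ‖x - y‖ := by
    intro y u x hu hx
    obtain ⟨u', hu', hn⟩ := hlip u y (w x) x hu (hw x hx).1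
    refine (hVmin x hx u' hu').trans ?_
    have hsplit : L (u', x) = L (u, y) + L (u' - u, x - y) := by rw [← map_add]; simp
    rw [hsplit]
    refine (norm_add_le _ _).trans (add_le_add_right ((hLle _).trans ?_) _)
    rw [hc', mul_assoc]
    refine mul_le_mul_of_nonneg_left ?_ hcL.le
    rw [Prod.norm_mk]
    have := norm_nonneg (x - y)
    exact max_le (by nlinarith) (by nlinarith)
  have hVup : ∀ x ∈ S.feasibleSet, V x ≤ c' * ‖x‖ := by
    intro x hx
    have h := hVlip 0 0 x (zero_mem_feasibleGraph hS) hx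
    have h0 : L ((0, 0) : S.InputTraj × S.State) = 0 := map_zero L
    rwa [h0, norm_zero, zero_add, sub_zero] at h
  have hnorm_le : ∀ u x, ‖x‖ ≤ c₁ * ‖L (u, x)‖ := fun u x =>
    (le_max_right _ _).trans (hLge (u, x))
  obtain ⟨a, ha⟩ : ∃ a : ℝ, a = 2 / (cQ * c' ^ 2) := ⟨_, rfl⟩
  have ha0 : 0 < a := by rw [ha]; positivity
  obtain ⟨η, hη⟩ : ∃ η : ℝ, η = Real.sqrt (1 - a) := ⟨_, rfl⟩
  have hη0 : 0 ≤ η := hη ▸ Real.sqrt_nonneg _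
  have hη1 : η < 1 := by
    rw [hη, Real.sqrt_lt' one_pos]
    linarith
  -- Contraction along the exact law.
  have hexact : ∀ x ∈ S.feasibleSet, ∃ u',
      (u', S.plant x (firstInput (w x)) 0) ∈ S.feasibleGraph ∧
        ‖L (u', S.plant x (firstInput (w x)) 0)‖ ≤ η * V x := by
    intro x hx
    obtain ⟨u', hu', hdec⟩ := exists_successor hS (hw x hx).1
    refine ⟨u', hu', ?_⟩
    have h1 := hL (u', S.plant x (firstInput (w x)) 0)
    have h2 := hL (w x, x)
    have h3 := hQ x
    have h4 : V x ^ 2 ≤ (c' * ‖x‖) ^ 2 := pow_le_pow_left₀ (hV0 x) (hVup x hx) 2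
    have h5 : a * V x ^ 2 ≤ 2 * ∑ i, (1 / 2) * wnormSq (S.Q i) (x i).ofLp := by
      rw [ha, div_mul_eq_mul_div, div_le_iff₀ (by positivity)]
      nlinarith [mul_le_mul_of_nonneg_left h3 (sq_nonneg c')]
    have h6 : ‖L (u', S.plant x (firstInput (w x)) 0)‖ ^ 2 ≤ (1 - a) * V x ^ 2 := by
      rw [hVw] at h2
      simp only at h1 h2
      linarith
    calc ‖L (u', S.plant x (firstInput (w x)) 0)‖
        = Real.sqrt (‖L (u', S.plant x (firstInput (w x)) 0)‖ ^ 2) :=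
          (Real.sqrt_sq (norm_nonneg _)).symm
      _ ≤ Real.sqrt ((1 - a) * V x ^ 2) := Real.sqrt_le_sqrt h6
      _ = η * V x := by rw [hη, Real.sqrt_mul' _ (sq_nonneg _), Real.sqrt_sq (hV0 x)]
  -- The regularization parameter is small enough to keep the contraction.
  obtain ⟨s, hs⟩ : ∃ s : ℝ, s = (1 - η) / 2 / (c' * (cF * ce)) := ⟨_, rfl⟩
  have hs0 : 0 < s := by
    have : 0 < 1 - η := by linarith
    rw [hs]; positivity
  refine ⟨V, c', c₁, c₁ + cF * ce * s + cB + 1, c' * (cB + 1), (1 + η) / 2, s ^ 2, hc'0, hc₁,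
    by positivity, by positivity, by positivity, by linarith, by positivity, hV0,
    fun x _ => hVw x ▸ hnorm_le (w x) x, hVup, ?_⟩
  intro ε hε hεt x hx δ d
  have hsε : Real.sqrt ε ≤ s := (Real.sqrt_le_left hs0.le).2 hεt
  obtain ⟨u, lam, hk⟩ := IsPenaltyKKT.exists_of_mem hL0 S.isPolyhedral_localGraph
    S.couplingMap S.b hε (hw x hx).1.1
  rw [kappa_eq_of_isPenaltyKKT hε hL hL0 hk]
  have hue := herr ε x u lam (w x) hε hk (hw x hx).1.1 (hw x hx).1.2
    fun v hvZ hvb => (hw x hx).2 v ⟨hvZ, hvb⟩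
  rw [hVw] at hue
  obtain ⟨v, hv, hvn⟩ := hexact x hx
  have hpl := plant_eq_add x (firstInput u + δ) (firstInput (w x)) d
  generalize S.plant x (firstInput (w x)) 0 = y at hv hvn hpl
  generalize S.plant x (firstInput u + δ) d = x' at hpl ⊢
  have hdist : ‖x' - y‖ ≤ cF * ce * s * V x + (cB + 1) * (‖δ‖ + ‖d‖) := by
    have hsub : firstInput u + δ - firstInput (w x) = firstInput (u - w x) + δ := by
      rw [map_sub]; abel
    rw [hpl, add_sub_cancel_left, hsub, map_add]
    have h1 : ‖S.inputMap (firstInput (u - w x))‖ ≤ cF * ce * s * V x := by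
      refine (hF (u - w x)).trans ?_
      rw [mul_assoc, mul_assoc]
      refine mul_le_mul_of_nonneg_left (hue.trans ?_) hcF.le
      rw [mul_assoc]
      exact mul_le_mul_of_nonneg_left (mul_le_mul_of_nonneg_right hsε (hV0 x)) hce.le
    have h2 := hB δ
    have h3 := norm_add_le (S.inputMap (firstInput (u - w x)) + S.inputMap δ) d
    have h4 := norm_add_le (S.inputMap (firstInput (u - w x))) (S.inputMap δ)
    have h5 := mul_nonneg hcB.le (norm_nonneg d)
    linarith [norm_nonneg δ]
  have hδd : 0 ≤ ‖δ‖ + ‖d‖ := by positivity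
  have hVx := hV0 x
  constructor
  · have h1 : ‖y‖ ≤ c₁ * V x := by
      refine (hnorm_le v y).trans (mul_le_mul_of_nonneg_left (hvn.trans ?_) hc₁.le)
      nlinarith
    have h2 : ‖x'‖ ≤ ‖y‖ + ‖x' - y‖ := by
      simpa using norm_add_le y (x' - y)
    have h3 : 0 ≤ cF * ce * s := by positivity
    nlinarith [mul_nonneg hc₁.le hδd, mul_nonneg h3 hδd, mul_nonneg hcB.le hVx]
  · intro hx'Γ
    have h1 := hVlip y v x' hv hx'Γ
    have h2 := mul_le_mul_of_nonneg_left hdist hc'0.le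
    have h3 : c' * (cF * ce * s) = (1 - η) / 2 := by
      rw [hs]; field_simp
    have h4 : c' * (cF * ce * s * V x + (cB + 1) * (‖δ‖ + ‖d‖)) =
        (1 - η) / 2 * V x + c' * (cB + 1) * (‖δ‖ + ‖d‖) := by
      rw [← h3]; ring
    linarith

end MPCProblem

/-! ### Input-to-state stability -/

/-- The exponential comparison function `(r, t) ↦ C r θ ^ t` is of class `KL`. -/
theorem classKL_mul_rpow {C θ : ℝ≥0} (hC : 0 < C) (hθ : 0 < θ) (hθ1 : θ < 1) :
    ClassKL fun r t => C * r * θ ^ (t : ℝ) := by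
  refine ⟨fun t => ⟨by fun_prop, fun r r' h => ?_, by simp⟩, fun r hr => ⟨?_, fun t t' h => ?_, ?_⟩⟩
  · have := NNReal.rpow_pos (p := (t : ℝ)) hθ
    dsimp only
    gcongr
  · have h : Continuous fun t : ℝ≥0 => (θ : ℝ) ^ (t : ℝ) :=
      (Real.continuous_const_rpow (by exact_mod_cast hθ.ne')).comp NNReal.continuous_coe
    have this : Continuous fun t : ℝ≥0 => θ ^ (t : ℝ) := h.subtype_mk _
    exact continuous_const.mul this
  · have := NNReal.rpow_lt_rpow_of_exponent_gt hθ hθ1 (NNReal.coe_lt_coe.2 h)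
    dsimp only
    gcongr
  · have h : Tendsto (fun t : ℝ≥0 => θ ^ (t : ℝ)) atTop (𝓝 0) := by
      rw [← NNReal.tendsto_coe]
      have hθ0 : (-1 : ℝ) < θ := by linarith [θ.coe_nonneg]
      exact (tendsto_rpow_atTop_of_base_lt_one (θ : ℝ) hθ0 (by exact_mod_cast hθ1)).comp
        (NNReal.tendsto_coe_atTop.2 tendsto_id)
    simpa using h.const_mul (C * r)

theorem norm_le_supNorm {V : Type*} [Norm V] {v : ℕ → V}
    (hv : BddAbove (Set.range fun t => ‖v t‖)) (t : ℕ) : ‖v t‖ ≤ supNorm v :=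
  le_ciSup hv t

theorem mainTheorem1 (S : MPCProblem) (hS : S.StandingAssumption) :
    ∃ (εt γ₁ σ₁ ρ : ℝ) (β₁ : ℝ≥0 → ℝ≥0 → ℝ≥0),
      0 < εt ∧ 0 < γ₁ ∧ 0 < σ₁ ∧ 0 < ρ ∧ ClassKL β₁ ∧
      ∀ ε : ℝ, 0 < ε → ε ≤ εt →
      ∀ (x : ℕ → S.State) (δu : ℕ → S.Input) (d : ℕ → S.State),
        BddAbove (Set.range fun t => ‖δu t‖) →
        BddAbove (Set.range fun t => ‖d t‖) →
        (∀ t, x (t + 1) = S.plant (x t) (S.kappa ε (x t) + δu t) (d t)) →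
        (∀ t : ℕ, (∀ s ≤ t, x s ∈ S.feasibleSet) →
          ‖x t‖ ≤ β₁ ‖x 0‖₊ t + γ₁ * supNorm δu + σ₁ * supNorm d) ∧
        (‖x 0‖ ≤ ρ → supNorm δu ≤ ρ → supNorm d ≤ ρ → ∀ t, x t ∈ S.feasibleSet) := by
  obtain ⟨V, c₀, c₁, c₂, γ, θ, εt, hc₀, hc₁, hc₂, hγ, hθ, hθ1, hεt, hV0, hVge, hVle, hstep⟩ :=
    MPCProblem.exists_issLyapunov hS
  obtain ⟨r, hr, hball⟩ := MPCProblem.exists_ball_subset_feasibleSet hS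
  have h1θ : 0 < 1 - θ := by linarith
  set g : ℝ := γ / (1 - θ) with hg
  have hg0 : 0 < g := by positivity
  have hgθ : θ * g + γ = g := by rw [hg]; field_simp; ring
  -- On the ball of radius `ρ`, the a priori bounds keep the next state in the ball of radius `r`.
  set k : ℝ := c₂ * (c₀ + 2 * g + 2) + 1 with hk
  have hk1 : 1 ≤ k := by
    have : 0 ≤ c₂ * (c₀ + 2 * g + 2) := by positivity
    linarith
  have hk0 : 0 < k := by linarith
  refine ⟨εt, c₁ * g, c₁ * g, r / k,
    fun r t => Real.toNNReal (c₁ * c₀) * r * Real.toNNReal θ ^ (t : ℝ), hεt, by positivity,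
    by positivity, by positivity, classKL_mul_rpow (by simpa using mul_pos hc₁ hc₀) (by simpa)
      (by simpa), ?_⟩
  intro ε hε hεle x δu d hδu hd hx
  have hD : ∀ t, ‖δu t‖ + ‖d t‖ ≤ supNorm δu + supNorm d := fun t =>
    add_le_add (norm_le_supNorm hδu t) (norm_le_supNorm hd t)
  have hD0 : 0 ≤ supNorm δu + supNorm d := le_trans (by positivity) (hD 0)
  have hVt : ∀ t, (∀ s ≤ t, x s ∈ S.feasibleSet) →
      V (x t) ≤ θ ^ t * V (x 0) + g * (supNorm δu + supNorm d) := by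
    intro t
    induction t with
    | zero =>
      intro _
      have := mul_nonneg hg0.le hD0
      simpa using this
    | succ t ih =>
      intro hmem
      have h1 := ih fun s hs => hmem s (by omega)
      have h2 := (hstep ε hε hεle (x t) (hmem t (by omega)) (δu t) (d t)).2
      rw [← hx t] at h2
      have h3 := h2 (hmem _ le_rfl)
      have h4 := mul_le_mul_of_nonneg_left (hD t) hγ.le
      have h5 := mul_le_mul_of_nonneg_left h1 hθ.le
      calc V (x (t + 1)) ≤ θ * V (x t) + γ * (‖δu t‖ + ‖d t‖) := h3
        _ ≤ θ * (θ ^ t * V (x 0) + g * (supNorm δu + supNorm d)) +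
            γ * (supNorm δu + supNorm d) := add_le_add h5 h4
        _ = θ ^ (t + 1) * V (x 0) + (θ * g + γ) * (supNorm δu + supNorm d) := by ring
        _ = _ := by rw [hgθ]
  constructor
  · intro t hmem
    have h1 := hVge (x t) (hmem t le_rfl)
    have h2 := hVle (x 0) (hmem 0 (by omega))
    have h3 := hVt t hmem
    have hβ : ((Real.toNNReal (c₁ * c₀) * ‖x 0‖₊ * Real.toNNReal θ ^ (((t : ℝ≥0) : ℝ)) : ℝ≥0) : ℝ)
        = c₁ * c₀ * ‖x 0‖ * θ ^ t := by
      rw [NNReal.coe_natCast, NNReal.rpow_natCast, NNReal.coe_mul, NNReal.coe_mul, NNReal.coe_pow,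
        Real.coe_toNNReal _ hθ.le, Real.coe_toNNReal _ (by positivity), coe_nnnorm]
    rw [hβ]
    calc ‖x t‖ ≤ c₁ * (θ ^ t * (c₀ * ‖x 0‖) + g * (supNorm δu + supNorm d)) := by
          refine h1.trans (mul_le_mul_of_nonneg_left (h3.trans ?_) hc₁.le)
          gcongr
      _ = _ := by ring
  · intro hx0 hδρ hdρ
    have hρ0 : 0 < r / k := by positivity
    intro t
    induction t using Nat.strong_induction_on with
    | _ t ih =>
      rcases t with _ | t
      · refine hball _ (hx0.trans ?_)
        rw [div_le_iff₀ hk0]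
        nlinarith
      · have h1 := hVt t fun s hs => ih s (by omega)
        have h2 := (hstep ε hε hεle (x t) (ih t (by omega)) (δu t) (d t)).1
        rw [← hx t] at h2
        have h3 := hVle (x 0) (ih 0 (by omega))
        have h4 : θ ^ t * V (x 0) ≤ c₀ * (r / k) := by
          calc θ ^ t * V (x 0) ≤ 1 * V (x 0) :=
                mul_le_mul_of_nonneg_right (pow_le_one₀ hθ.le hθ1.le) (hV0 _)
            _ ≤ c₀ * (r / k) := by
                rw [one_mul]
                exact h3.trans (mul_le_mul_of_nonneg_left hx0 hc₀.le)
        have hDρ : supNorm δu + supNorm d ≤ 2 * (r / k) := by linarith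
        have h5 := mul_le_mul_of_nonneg_left hDρ hg0.le
        refine hball _ (h2.trans ?_)
        calc c₂ * (V (x t) + (‖δu t‖ + ‖d t‖))
            ≤ c₂ * ((c₀ + 2 * g + 2) * (r / k)) :=
              mul_le_mul_of_nonneg_left (by linarith [hD t]) hc₂.le
          _ ≤ k * (r / k) := by rw [← mul_assoc]; gcongr; linarith
          _ = r := by field_simp

end
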